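/- Let $d\ge 2$ be an integer and $\mathbb{T}^d=(\mathbb{R}/2\pi\mathbb{Z})^d$. For $k\in\mathbb{Z}^d$ put $e_k(x)=(2\pi)^{-d/2}e^{ik\cdot x}$ and let $v_k=\int_{\mathbb{T}^d}\overline{e_k}\,v\,dx\in\mathbb{C}^d$ be the Fourier coefficients of a vector field $v:\mathbb{T}^d\to\mathbb{R}^d$. For real $m\ge 0$ let $\mathbb{H}^m$ be the space of vector fields $v\in L^2(\mathbb{T}^d,\mathbb{R}^d)$ with zero divergence ($k\cdot v_k=0$ for all $k$), zero mean ($v_0=0$) and $\sum_{k\ne 0}|k|^{2m}|v_k|^2<\infty$, with inner product $\langle v|w\rangle_m=\sum_{k\neq 0}|k|^{2m}\,\overline{v_k}\cdot w_k$ and norm $\|v\|_m=\sqrt{\langle v|v\rangle_m}$. Let $\mathcal{P}(v,w)=\mathfrak{L}(v\cdot\partial w)$, where $v\cdot\partial w=\sum_{r=1}^d v_r\,\partial_r w$ (distributional derivatives) and $\mathfrak{L}$ is the Leray projection onto divergence free vector fields, acting on the $k$-th Fourier coefficient as the orthogonal projection of $\mathbb{C}^d$ onto $\{c : k\cdot c=0\}$.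 Fix a real number $n>d/2+1$. For each real $p\ge n$, one has $\mathcal{P}(v,w)\in\mathbb{H}^p$ for all $v\in\mathbb{H}^p$, $w\in\mathbb{H}^{p+1}$, and there is a smallest real constant $G_{pn}$ (depending on $d,p,n$) such that the tame Kato inequality $$|\langle\mathcal{P}(v,w)|w\rangle_p|\le\tfrac12\,G_{pn}\,\big(\|v\|_p\|w\|_n+\|v\|_n\|w\|_p\big)\,\|w\|_p$$ holds for all $v\in\mathbb{H}^p$ and $w\in\mathbb{H}^{p+1}$. Moreover $$(G_{pn})^{1/p}\to 2\qquad\text{as } p\to+\infty .$$ -/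

import Mathlib

open MeasureTheory Filter Topology
open scoped ContDiff ComplexConjugate

namespace TameKato

instance fact_two_pi_pos : Fact (0 < 2 * Real.pi) := ⟨Real.two_pi_pos⟩

/-- The torus `(ℝ / 2πℤ)^d`. Its measure `volume` is the product of the Lebesgue measures
of the circles of length `2π`, of total mass `(2π)^d`. -/
abbrev Torus (d : ℕ) : Type := Fin d → AddCircle (2 * Real.pi)

/-- (Not necessarily regular) real vector fields on the torus. -/
abbrev Field (d : ℕ) : Type := Torus d → EuclideanSpace ℝ (Fin d)

/-- The Euclidean length `|k|` of a lattice point `k ∈ ℤ^d`. -/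
noncomputable def latticeNorm {d : ℕ} (k : Fin d → ℤ) : ℝ :=
  Real.sqrt (∑ r, (k r : ℝ) ^ 2)

/-- The (bilinear) product `k · c = ∑ r, k_r c_r` for `k ∈ ℤ^d`, `c ∈ ℂ^d`. -/
noncomputable def latticeDot {d : ℕ} (k : Fin d → ℤ) (c : EuclideanSpace ℂ (Fin d)) : ℂ :=
  ∑ r, (k r : ℂ) * c r

/-- The function `e_k(x) = (2π)^(-d/2) exp(i k·x)` on the torus; on the circle of length `2π`,
`fourier m` is the function `x ↦ exp(i m x)`. -/
noncomputable def fourierMode {d : ℕ} (k : Fin d → ℤ) (x : Torus d) : ℂ :=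
  (((2 * Real.pi) ^ (-(d : ℝ) / 2) : ℝ) : ℂ) * ∏ r, fourier (k r) (x r)

/-- The Fourier coefficient `v_k = ∫ conj(e_k(x)) v(x) dx ∈ ℂ^d` of a vector field. -/
noncomputable def coeff {d : ℕ} (v : Field d) (k : Fin d → ℤ) : EuclideanSpace ℂ (Fin d) :=
  WithLp.toLp 2 fun s => ∫ x, conj (fourierMode k x) * ((v x s : ℝ) : ℂ)

/-- The Sobolev space of order `m` of real vector fields with zero divergence and mean.
For `m ≥ 0`, the only orders in use, its elements are square integrable, so they are
represented as (classes of) functions. -/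
structure MemSobolev {d : ℕ} (m : ℝ) (v : Field d) : Prop where
  memLp : MemLp v 2 volume
  div_free : ∀ k, latticeDot k (coeff v k) = 0
  mean_zero : coeff v 0 = 0
  summable : Summable fun k : {k : Fin d → ℤ // k ≠ 0} =>
    latticeNorm k.1 ^ (2 * m) * ‖coeff v k.1‖ ^ 2

/-- The inner product `⟨v|w⟩_m = ∑_{k ≠ 0} |k|^(2m) conj(v_k) · w_k`. -/
noncomputable def sobolevInner {d : ℕ} (m : ℝ) (v w : Field d) : ℂ :=
  ∑' k : {k : Fin d → ℤ // k ≠ 0},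
    ((latticeNorm k.1 ^ (2 * m) : ℝ) : ℂ) * ∑ s, conj (coeff v k.1 s) * coeff w k.1 s

/-- The norm `‖v‖_m = √⟨v|v⟩_m`. -/
noncomputable def sobolevNorm {d : ℕ} (m : ℝ) (v : Field d) : ℝ :=
  Real.sqrt (sobolevInner m v v).re

/-- Real `C^∞` functions on the torus: their periodic lifts to `ℝ^d` are `C^∞`. -/
def IsSmooth {d : ℕ} (φ : Torus d → ℝ) : Prop :=
  ContDiff ℝ ∞ fun y : Fin d → ℝ => φ fun r => (y r : AddCircle (2 * Real.pi))

/-- The classical partial derivative `∂_r φ` of a function on the torus. -/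
noncomputable def classicalPartial {d : ℕ} (r : Fin d) (φ : Torus d → ℝ) (x : Torus d) : ℝ :=
  deriv (fun t : ℝ => φ (Function.update x r (x r + (t : AddCircle (2 * Real.pi))))) 0

/-- `g` is the distributional derivative `∂_r w`. -/
def IsWeakPartial {d : ℕ} (r : Fin d) (w g : Field d) : Prop :=
  ∀ φ : Torus d → ℝ, IsSmooth φ →
    ∫ x, φ x • g x = -∫ x, classicalPartial r φ x • w x

open Classical in
/-- The distributional derivative `∂_r w`, when it is in `L²` (it is then unique up to null sets,
and one representative is chosen). -/
noncomputable def weakPartial {d : ℕ} (r : Fin d) (w : Field d) : Field d :=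
  if h : ∃ g : Field d, MemLp g 2 volume ∧ IsWeakPartial r w g then h.choose else 0

/-- The vector field `v · ∂w = ∑ r, v_r ∂_r w`. -/
noncomputable def advection {d : ℕ} (v w : Field d) : Field d :=
  fun x => ∑ r, v x r • weakPartial r w x

/-- The orthogonal projection of `ℂ^d` onto `{c | k · c = 0}`, that is
`c ↦ c - (k·c / |k|²) k` for `k ≠ 0` and the identity for `k = 0`
(in this case the subtracted term below is `0`). -/
noncomputable def leraySymbol {d : ℕ} (k : Fin d → ℤ) (c : EuclideanSpace ℂ (Fin d)) :
    EuclideanSpace ℂ (Fin d) :=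
  WithLp.toLp 2 fun s => c s - latticeDot k c / ((latticeNorm k ^ 2 : ℝ) : ℂ) * (k s : ℂ)

open Classical in
/-- The Leray projection: the field with Fourier coefficients `𝔏_k f_k`, when it is in `L²` (as is
the case if `f` is in `L²`; it is then unique up to null sets, and one representative is chosen). -/
noncomputable def leray {d : ℕ} (f : Field d) : Field d :=
  if h : ∃ g : Field d, MemLp g 2 volume ∧ ∀ k, coeff g k = leraySymbol k (coeff f k)
  then h.choose else 0

/-- The Navier–Stokes bilinear map `𝒫(v, w) = 𝔏(v · ∂w)`. -/
noncomputable def nsBilinear {d : ℕ} (v w : Field d) : Field d :=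
  leray (advection v w)

/-- The constants for which the tame Kato inequality of orders `p, n` holds. -/
def tameKatoConstants (d : ℕ) (p n : ℝ) : Set ℝ :=
  {C | ∀ v w : Field d, MemSobolev p v → MemSobolev (p + 1) w →
    ‖sobolevInner p (nsBilinear v w) w‖ ≤
      1 / 2 * C * (sobolevNorm p v * sobolevNorm n w + sobolevNorm n v * sobolevNorm p w) *
        sobolevNorm p w}

/-- The sharp constant `G_{pn}` of the tame Kato inequality, in dimension `d`. -/
noncomputable def sharpKato (d : ℕ) (p n : ℝ) : ℝ :=
  sInf (tameKatoConstants d p n)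

end TameKato

/-!
On the Fourier side `⟨𝒫(v, w) | w⟩_p` is the double series
`∑_{k, l} |k|^(2p) conj (i (2π)^(-d/2) v_{k-l}·l) (conj w_l · w_k)`; the Leray projection drops
out because `w_k` is orthogonal to `k` (`sobolevInner_nsBilinear_eq_tsum`). As `v` is divergence
free and the fields are real, the summand without its weight changes sign under
`(k, l) ↦ (-l, -k)` (`triadTerm_neg_swap`). Hence one factor `|k|^p` of the weight can be replaced
by `|k|^p - |l|^p` (`sobolevInner_nsBilinear_eq_commutator`), which saves the derivative of `w`.

Upper bound. With `h = k - l`, the mean value inequality and `|k| ≤ |h| + |l|` give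
`||k|^p - |l|^p| |l| ≤ p 2^(p-2) (|h| |l|^p + |h|^p |l|)` (`abs_rpow_sub_rpow_mul_le`). The two
terms on the right match the two terms of the tame inequality: Young's inequality `ℓ¹ * ℓ² ⊆ ℓ²`
(`young_trilinear`) and the embedding `∑ |h| |v_h| ≤ c ‖v‖_n`, which is where `n > d/2 + 1` enters,
show that a constant multiple of `p 2^p` is admissible (`mem_tameKatoConstants`).

Lower bound. The factor `2^p` is lost only for `|h| ≈ |l|` and `h`, `l` nearly parallel. They cannot
be parallel, since then `v_h·l = 0`. So `v` is taken with the frequencies `±(N, 1)` and `w` with the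
frequencies `±(N, 0)` and `±(2N, 1)`, the latter with an amplitude which makes the two parts of
`‖w‖_p` comparable. For fixed `N` this bounds the admissible constants below by
`c_N (|(2N, 1)| / |(N, 1)|)^p` (`exists_lower_bound`), and the ratio tends to `2` as `N → ∞`.

The set of admissible constants is closed, nonempty and bounded below, so it has a least element.

The coefficients of the weak derivatives, of products and of the Leray projection come from the
fact that the modes `e_k` form a Hilbert basis (`modeBasis`), in the form of Parseval's identity
(`hasSum_scalarCoeff`) and the Riesz–Fischer theorem (`exists_field_coeff_eq`).
-/

namespace TameKato

section

/-! ### The exponential basis of `L²` of the torus -/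

/-- The normalization `(2π)^(-d/2)` of the modes `e_k`. -/
noncomputable def modeConst (d : ℕ) : ℝ := (2 * Real.pi) ^ (-(d : ℝ) / 2)

lemma modeConst_pos (d : ℕ) : 0 < modeConst d := Real.rpow_pos_of_pos Real.two_pi_pos _

lemma modeConst_sq (d : ℕ) : modeConst d ^ 2 * (2 * Real.pi) ^ d = 1 := by
  have h := Real.two_pi_pos
  rw [modeConst, ← Real.rpow_natCast, ← Real.rpow_mul h.le, ← Real.rpow_natCast (2 * Real.pi) d,
    ← Real.rpow_add h]
  norm_num

variable {d : ℕ}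

/-- The unnormalized exponential `exp (i k·x)`, as a continuous map. -/
noncomputable def character (k : Fin d → ℤ) : C(Torus d, ℂ) where
  toFun x := ∏ r, fourier (k r) (x r)
  continuous_toFun := by fun_prop

lemma character_apply (k : Fin d → ℤ) (x : Torus d) :
    character k x = ∏ r, fourier (k r) (x r) := rfl

lemma fourierMode_eq (k : Fin d → ℤ) (x : Torus d) :
    fourierMode k x = (modeConst d : ℂ) * character k x := rfl

lemma character_neg (k : Fin d → ℤ) (x : Torus d) :
    character (-k) x = conj (character k x) := by
  simp only [character_apply, Pi.neg_apply, fourier_neg, map_prod]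

lemma character_add (j k : Fin d → ℤ) (x : Torus d) :
    character (j + k) x = character j x * character k x := by
  simp only [character_apply, Pi.add_apply, fourier_add, Finset.prod_mul_distrib]

lemma character_zero (x : Torus d) : character (0 : Fin d → ℤ) x = 1 := by
  simp only [character_apply, Pi.zero_apply, fourier_zero, Finset.prod_const_one]

lemma norm_character (k : Fin d → ℤ) (x : Torus d) : ‖character k x‖ = 1 := by
  simp [character_apply, norm_prod, Circle.norm_coe]

lemma continuous_fourierMode (k : Fin d → ℤ) : Continuous (fourierMode k) :=
  continuous_const.mul (character k).continuous

lemma fourierMode_neg (k : Fin d → ℤ) (x : Torus d) :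
    fourierMode (-k) x = conj (fourierMode k x) := by
  simp [fourierMode_eq, character_neg]

lemma conj_fourierMode_mul (j k : Fin d → ℤ) (x : Torus d) :
    conj (fourierMode j x) * fourierMode k x =
      (modeConst d : ℂ) * conj (fourierMode (j - k) x) := by
  rw [← fourierMode_neg, ← fourierMode_neg]
  simp only [fourierMode_eq, show -(j - k) = -j + k by abel, character_add]
  ring

/-- The mode `e_k` as a bundled continuous map. -/
noncomputable def modeMap (k : Fin d → ℤ) : C(Torus d, ℂ) :=
  ⟨fourierMode k, continuous_fourierMode k⟩

/-- The star subalgebra of `C(Torus d, ℂ)` generated by the characters. -/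
noncomputable def characterSubalgebra (d : ℕ) : StarSubalgebra ℂ C(Torus d, ℂ) where
  toSubalgebra := Algebra.adjoin ℂ (Set.range character)
  star_mem' := by
    change Algebra.adjoin ℂ (Set.range character) ≤ star (Algebra.adjoin ℂ (Set.range character))
    refine Algebra.adjoin_le ?_
    rintro _ ⟨n, rfl⟩
    refine Algebra.subset_adjoin ⟨-n, ?_⟩
    ext1 x
    simp only [character_neg, starRingEnd_apply, ContinuousMap.star_apply]

lemma characterSubalgebra_coe :
    Subalgebra.toSubmodule (characterSubalgebra d).toSubalgebra =
      Submodule.span ℂ (Set.range (character (d := d))) := by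
  apply Algebra.adjoin_eq_span_of_subset
  refine .trans (fun x ↦ Submonoid.closure_induction (fun _ ↦ id) ⟨0, ?_⟩ ?_) Submodule.subset_span
  · ext z
    simp [character_zero]
  · rintro _ _ _ _ ⟨m, rfl⟩ ⟨n, rfl⟩
    refine ⟨m + n, ?_⟩
    ext z
    simp [character_add]

lemma character_single (z : Torus d) (i : Fin d) :
    character (Pi.single i 1) z = fourier 1 (z i) := by
  rw [character_apply, Finset.prod_eq_single i]
  · rw [Pi.single_eq_same]
  · intro j _ hj
    rw [Pi.single_eq_of_ne hj, fourier_zero]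
  · simp

lemma characterSubalgebra_separatesPoints :
    (characterSubalgebra d).toSubalgebra.SeparatesPoints := by
  intro x y hxy
  rw [Ne, funext_iff, not_forall] at hxy
  obtain ⟨i, hi⟩ := hxy
  refine ⟨_, ⟨character (Pi.single i 1), Algebra.subset_adjoin ⟨Pi.single i 1, rfl⟩, rfl⟩, ?_⟩
  dsimp only
  rw [character_single, character_single, fourier_one, fourier_one]
  exact fun h => hi (AddCircle.injective_toCircle Real.two_pi_pos.ne' (Subtype.coe_injective h))

lemma span_modeMap_closure_eq_top :
    (Submodule.span ℂ (Set.range (modeMap (d := d)))).topologicalClosure = ⊤ := by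
  have h1 : Submodule.span ℂ (Set.range (modeMap (d := d))) =
      Submodule.span ℂ (Set.range (character (d := d))) := by
    have hc : (modeConst d : ℂ) ≠ 0 := by exact_mod_cast (modeConst_pos d).ne'
    apply le_antisymm <;> rw [Submodule.span_le] <;> rintro _ ⟨k, rfl⟩
    · have : modeMap k = (modeConst d : ℂ) • character k := by ext x; rfl
      rw [this]
      exact Submodule.smul_mem _ _ (Submodule.subset_span ⟨k, rfl⟩)
    · have : character k = (modeConst d : ℂ)⁻¹ • modeMap k := by
        ext x
        simp [modeMap, fourierMode_eq, hc]
      rw [this]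
      exact Submodule.smul_mem _ _ (Submodule.subset_span ⟨k, rfl⟩)
  rw [h1, ← characterSubalgebra_coe]
  exact congr_arg (Subalgebra.toSubmodule <| StarSubalgebra.toSubalgebra ·)
    (ContinuousMap.starSubalgebra_topologicalClosure_eq_top_of_separatesPoints _
      characterSubalgebra_separatesPoints)

/-- The mode `e_k` as an element of `L²`. -/
noncomputable def modeLp (k : Fin d → ℤ) : Lp ℂ 2 (volume : Measure (Torus d)) :=
  ContinuousMap.toLp (E := ℂ) 2 volume ℂ (modeMap k)

lemma coeFn_modeLp (k : Fin d → ℤ) : modeLp k =ᵐ[volume] fourierMode k :=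
  ContinuousMap.coeFn_toLp volume (modeMap k)

lemma span_modeLp_closure_eq_top :
    (Submodule.span ℂ (Set.range (modeLp (d := d)))).topologicalClosure = ⊤ := by
  have h := (ContinuousMap.toLp_denseRange ℂ (volume : Measure (Torus d)) ℂ
    (p := 2) (by simp)).topologicalClosure_map_submodule span_modeMap_closure_eq_top
  rw [Submodule.map_span, ← Set.range_comp] at h
  exact h

lemma integral_fourier (m : ℤ) :
    ∫ x : AddCircle (2 * Real.pi), fourier m x = if m = 0 then ((2 * Real.pi : ℝ) : ℂ) else 0 := by
  split_ifs with h
  · subst h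
    simp only [fourier_zero, integral_const]
    simp [measureReal_def, AddCircle.measure_univ, Real.pi_pos.le]
  · exact integral_eq_zero_of_add_right_eq_neg
      (fourier_add_half_inv_index h Real.two_pi_pos)

lemma integral_character (k : Fin d → ℤ) :
    ∫ x, character k x = if k = 0 then (((2 * Real.pi) ^ d : ℝ) : ℂ) else 0 := by
  simp only [character_apply]
  rw [MeasureTheory.integral_fintype_prod_volume_eq_prod]
  simp only [integral_fourier]
  split_ifs with h
  · subst h
    simp
  · obtain ⟨i, hi⟩ := Function.ne_iff.mp h
    exact Finset.prod_eq_zero (Finset.mem_univ i) (if_neg hi)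

lemma orthonormal_modeLp : Orthonormal ℂ (modeLp (d := d)) := by
  rw [orthonormal_iff_ite]
  intro m n
  rw [modeLp, modeLp, ContinuousMap.inner_toLp]
  have h1 : ∀ x : Torus d, modeMap n x * conj (modeMap m x) =
      ((modeConst d ^ 2 : ℝ) : ℂ) * character (n - m) x := by
    intro x
    change fourierMode n x * conj (fourierMode m x) = _
    rw [← fourierMode_neg, fourierMode_eq, fourierMode_eq, sub_eq_add_neg, character_add]
    push_cast
    ring
  simp only [h1]
  rw [integral_const_mul, integral_character]
  simp only [sub_eq_zero, eq_comm (a := n)]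
  split_ifs with h
  · rw [← Complex.ofReal_mul, modeConst_sq, Complex.ofReal_one]
  · simp

/-- The modes `e_k` form a Hilbert basis of `L²` of the torus. -/
noncomputable def modeBasis (d : ℕ) :
    HilbertBasis (Fin d → ℤ) ℂ (Lp ℂ 2 (volume : Measure (Torus d))) :=
  HilbertBasis.mk orthonormal_modeLp span_modeLp_closure_eq_top.ge

/-! ### Fourier coefficients -/

/-- The Fourier coefficient of a complex function on the torus. -/
noncomputable def scalarCoeff (f : Torus d → ℂ) (k : Fin d → ℤ) : ℂ :=
  ∫ x, conj (fourierMode k x) * f x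

lemma coeff_apply (v : Field d) (k : Fin d → ℤ) (s : Fin d) :
    coeff v k s = scalarCoeff (fun x => ((v x s : ℝ) : ℂ)) k := rfl

lemma modeBasis_repr (f : Lp ℂ 2 (volume : Measure (Torus d))) (k : Fin d → ℤ) :
    (modeBasis d).repr f k = scalarCoeff f k := by
  rw [(modeBasis d).repr_apply_apply f k, MeasureTheory.L2.inner_def, modeBasis,
    HilbertBasis.coe_mk]
  apply integral_congr_ae
  filter_upwards [coeFn_modeLp k] with x hx
  simp only [RCLike.inner_apply, hx, mul_comm]

lemma scalarCoeff_congr {f g : Torus d → ℂ} (h : f =ᵐ[volume] g) (k : Fin d → ℤ) :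
    scalarCoeff f k = scalarCoeff g k := by
  apply integral_congr_ae
  filter_upwards [h] with x hx
  rw [hx]

/-- Parseval's identity. -/
lemma hasSum_scalarCoeff {f g : Torus d → ℂ} (hf : MemLp f 2 volume) (hg : MemLp g 2 volume) :
    HasSum (fun k => conj (scalarCoeff f k) * scalarCoeff g k) (∫ x, conj (f x) * g x) := by
  have h := (modeBasis d).hasSum_inner_mul_inner (hf.toLp f) (hg.toLp g)
  have h2 : inner ℂ (hf.toLp f) (hg.toLp g) = ∫ x, conj (f x) * g x := by
    rw [MeasureTheory.L2.inner_def]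
    apply integral_congr_ae
    filter_upwards [hf.coeFn_toLp, hg.coeFn_toLp] with x hx hy
    simp only [RCLike.inner_apply, hx, hy, mul_comm]
  rw [h2] at h
  refine h.congr_fun fun k => ?_
  rw [← inner_conj_symm (hf.toLp f), ← HilbertBasis.repr_apply_apply,
    ← HilbertBasis.repr_apply_apply, modeBasis_repr, modeBasis_repr,
    scalarCoeff_congr hf.coeFn_toLp, scalarCoeff_congr hg.coeFn_toLp]

/-- The Riesz–Fischer theorem. -/
lemma exists_scalarCoeff_eq {c : (Fin d → ℤ) → ℂ} (hc : Summable fun k => ‖c k‖ ^ 2) :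
    ∃ f : Torus d → ℂ, MemLp f 2 volume ∧ ∀ k, scalarCoeff f k = c k := by
  have hm : Memℓp c 2 := memℓp_gen (by simpa using hc)
  refine ⟨(modeBasis d).repr.symm ⟨c, hm⟩, Lp.memLp _, fun k => ?_⟩
  rw [← modeBasis_repr, LinearIsometryEquiv.apply_symm_apply]

lemma memLp_component {v : Field d} (hv : MemLp v 2 volume) (s : Fin d) :
    MemLp (fun x => ((v x s : ℝ) : ℂ)) 2 volume :=
  (MemLp.eval_piLp hv s).ofReal

lemma scalarCoeff_neg_of_real (f : Torus d → ℝ) (k : Fin d → ℤ) :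
    scalarCoeff (fun x => (f x : ℂ)) (-k) = conj (scalarCoeff (fun x => (f x : ℂ)) k) := by
  rw [scalarCoeff, scalarCoeff, ← integral_conj]
  simp [fourierMode_neg]

lemma coeff_neg (v : Field d) (k : Fin d → ℤ) (s : Fin d) :
    coeff v (-k) s = conj (coeff v k s) := by
  simp only [coeff_apply]
  exact scalarCoeff_neg_of_real (fun x => v x s) k

lemma memLp_fourierMode (k : Fin d → ℤ) : MemLp (fourierMode k) 2 volume := by
  exact (memLp_congr_ae (coeFn_modeLp k)).mp (Lp.memLp _)

lemma integrable_conj_fourierMode_mul {f : Torus d → ℂ} (hf : MemLp f 2 volume)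
    (k : Fin d → ℤ) : Integrable fun x => conj (fourierMode k x) * f x := by
  simp only [← fourierMode_neg]
  exact (memLp_fourierMode (-k)).integrable_mul hf

/-- Every square summable family of vectors with the reality symmetry is the family of Fourier
coefficients of a real square integrable field. -/
lemma exists_field_coeff_eq {c : (Fin d → ℤ) → EuclideanSpace ℂ (Fin d)}
    (hc : Summable fun k => ‖c k‖ ^ 2) (hreal : ∀ k s, c (-k) s = conj (c k s)) :
    ∃ v : Field d, MemLp v 2 volume ∧ ∀ k, coeff v k = c k := by
  have h1 : ∀ s, ∃ f : Torus d → ℂ, MemLp f 2 volume ∧ ∀ k, scalarCoeff f k = c k s := by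
    intro s
    refine exists_scalarCoeff_eq (hc.of_nonneg_of_le (fun k => by positivity) fun k => ?_)
    gcongr
    exact PiLp.norm_apply_le (c k) s
  choose f hf hfc using h1
  refine ⟨fun x => WithLp.toLp 2 fun s => (f s x).re, MemLp.of_eval_piLp fun s => (hf s).re, ?_⟩
  intro k
  ext s
  -- `Re f = (f + conj f) / 2`, and `conj f` has the same coefficients as `f`
  have hconj : ∫ x, conj (fourierMode k x) * conj (f s x) = c k s := by
    have := hfc s (-k)
    rw [hreal, scalarCoeff] at this
    have h2 := congrArg conj this
    rw [← integral_conj] at h2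
    simpa [fourierMode_neg] using h2
  have hre : ∀ x, conj (fourierMode k x) * (((f s x).re : ℝ) : ℂ) =
      (1 / 2 : ℂ) * (conj (fourierMode k x) * f s x + conj (fourierMode k x) * conj (f s x)) := by
    intro x
    rw [Complex.re_eq_add_conj]
    ring
  rw [coeff_apply, scalarCoeff]
  simp only [hre]
  have hfs : MemLp (fun x => conj (f s x)) 2 volume := (hf s).star
  rw [integral_const_mul, integral_add (integrable_conj_fourierMode_mul (hf s) k)
    (integrable_conj_fourierMode_mul hfs k), hconj]
  have := hfc s k
  rw [scalarCoeff] at this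
  rw [this]
  ring

end

section

variable {d : ℕ}

/-! ### Weak derivatives and Fourier coefficients -/

/-- The covering map `ℝ^d → (ℝ / 2πℤ)^d`. -/
noncomputable def toTorus (y : Fin d → ℝ) : Torus d := fun r => (y r : AddCircle (2 * Real.pi))

lemma isOpenQuotientMap_toTorus : IsOpenQuotientMap (toTorus (d := d)) :=
  IsOpenQuotientMap.piMap fun _ => QuotientAddGroup.isOpenQuotientMap_mk

lemma update_toTorus (y : Fin d → ℝ) (r : Fin d) (t : ℝ) :
    Function.update (toTorus y) r (toTorus y r + (t : AddCircle (2 * Real.pi))) =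
      toTorus (y + t • Pi.single r 1) := by
  ext s
  by_cases h : s = r
  · subst h; simp [toTorus]
  · simp [toTorus, h]

lemma update_eq_add_single (x : Torus d) (r : Fin d) (t : AddCircle (2 * Real.pi)) :
    Function.update x r (x r + t) = x + Pi.single r t := by
  ext s
  by_cases h : s = r
  · subst h; simp
  · simp [h]

lemma IsSmooth.continuous {φ : Torus d → ℝ} (hφ : IsSmooth φ) : Continuous φ :=
  isOpenQuotientMap_toTorus.isQuotientMap.continuous_iff.mpr (ContDiff.continuous hφ)

lemma IsSmooth.hasDerivAt {φ : Torus d → ℝ} (hφ : IsSmooth φ) (r : Fin d) (y : Fin d → ℝ) :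
    HasDerivAt (fun t : ℝ => φ (toTorus (y + t • Pi.single r 1)))
      (fderiv ℝ (φ ∘ toTorus) y (Pi.single r 1)) 0 := by
  have h1 : HasFDerivAt (φ ∘ toTorus) (fderiv ℝ (φ ∘ toTorus) y) y :=
    ((ContDiff.differentiable hφ (by simp)) y).hasFDerivAt
  exact h1.hasLineDerivAt (Pi.single r 1)

lemma IsSmooth.classicalPartial_toTorus {φ : Torus d → ℝ} (hφ : IsSmooth φ) (r : Fin d)
    (y : Fin d → ℝ) :
    classicalPartial r φ (toTorus y) = fderiv ℝ (φ ∘ toTorus) y (Pi.single r 1) := by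
  rw [classicalPartial]
  simp only [update_toTorus]
  exact (hφ.hasDerivAt r y).deriv

lemma IsSmooth.continuous_classicalPartial {φ : Torus d → ℝ} (hφ : IsSmooth φ) (r : Fin d) :
    Continuous (classicalPartial r φ) := by
  refine isOpenQuotientMap_toTorus.isQuotientMap.continuous_iff.mpr ?_
  have h : classicalPartial r φ ∘ toTorus = fun y => fderiv ℝ (φ ∘ toTorus) y (Pi.single r 1) :=
    funext fun y => hφ.classicalPartial_toTorus r y
  rw [h]
  exact (ContDiff.continuous_fderiv hφ (by simp)).clm_apply continuous_const

lemma IsSmooth.hasDerivAt_add_single {φ : Torus d → ℝ} (hφ : IsSmooth φ) (r : Fin d)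
    (x : Torus d) (t : ℝ) :
    HasDerivAt (fun t : ℝ => φ (x + Pi.single r (t : AddCircle (2 * Real.pi))))
      (classicalPartial r φ (x + Pi.single r (t : AddCircle (2 * Real.pi)))) t := by
  obtain ⟨y, rfl⟩ := isOpenQuotientMap_toTorus.surjective x
  have h1 : ∀ s : ℝ, toTorus y + Pi.single r (s : AddCircle (2 * Real.pi)) =
      toTorus (y + s • Pi.single r 1) := fun s => by
    rw [← update_eq_add_single, update_toTorus]
  simp only [h1]
  rw [hφ.classicalPartial_toTorus]
  have h2 := hφ.hasDerivAt r (y + t • Pi.single r 1)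
  rw [← sub_self t] at h2
  have h3 := HasDerivAt.comp_sub_const t t h2
  refine h3.congr_of_eventuallyEq (Eventually.of_forall fun s => ?_)
  simp only [add_assoc, ← add_smul, add_sub_cancel]

lemma fourier_coe_two_pi (m : ℤ) (t : ℝ) :
    fourier m (t : AddCircle (2 * Real.pi)) = Complex.exp (Complex.I * m * t) := by
  rw [fourier_coe_apply]
  congr 1
  have : (Real.pi : ℂ) ≠ 0 := by exact_mod_cast Real.pi_ne_zero
  push_cast
  field_simp

lemma character_add_single (k : Fin d → ℤ) (x : Torus d) (r : Fin d) (t : ℝ) :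
    character k (x + Pi.single r (t : AddCircle (2 * Real.pi))) =
      character k x * Complex.exp (Complex.I * k r * t) := by
  have h1 : ∀ x y : Torus d, character k (x + y) = character k x * character k y := by
    intro x y
    simp only [character_apply, Pi.add_apply, ← Finset.prod_mul_distrib, fourier_apply,
      smul_add, AddCircle.toCircle_add, Circle.coe_mul]
  rw [h1, ← fourier_coe_two_pi]
  congr 1
  rw [character_apply, Finset.prod_eq_single r]
  · rw [Pi.single_eq_same]
  · intro j _ hj
    rw [Pi.single_eq_of_ne hj, fourier_eval_zero]
  · simp

lemma memLp_of_continuous {f : Torus d → ℝ} (hf : Continuous f) :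
    MemLp (fun x => (f x : ℂ)) 2 volume :=
  (hf.memLp_of_hasCompactSupport (HasCompactSupport.of_compactSpace f)).ofReal

/-- Fourier coefficients of a classical derivative: differentiate
`∫ conj (e_k x) φ(x + t) dx = exp (i k_r t) φ_k` at `t = 0`. -/
lemma IsSmooth.scalarCoeff_classicalPartial {φ : Torus d → ℝ} (hφ : IsSmooth φ) (r : Fin d)
    (k : Fin d → ℤ) :
    scalarCoeff (fun x => (classicalPartial r φ x : ℂ)) k =
      Complex.I * k r * scalarCoeff (fun x => (φ x : ℂ)) k := by
  set F : ℝ → Torus d → ℂ := fun t x =>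
    conj (fourierMode k x) * (φ (x + Pi.single r (t : AddCircle (2 * Real.pi))) : ℂ) with hF
  set F' : ℝ → Torus d → ℂ := fun t x => conj (fourierMode k x) *
    (classicalPartial r φ (x + Pi.single r (t : AddCircle (2 * Real.pi))) : ℂ) with hF'
  have hcont : Continuous (fourierMode k) := continuous_fourierMode k
  have hφc := hφ.continuous
  have hpc := hφ.continuous_classicalPartial r
  obtain ⟨B, hB⟩ := isCompact_univ.exists_bound_of_continuousOn hpc.continuousOn
  have hFm : ∀ t, Continuous (F t) := fun t => by
    simp only [hF]
    fun_prop
  have hF'm : Continuous (F' 0) := by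
    simp only [hF']
    fun_prop
  have hder := (hasDerivAt_integral_of_dominated_loc_of_deriv_le (μ := volume) (F := F) (F' := F')
    (x₀ := 0) (s := Set.univ) (bound := fun _ => modeConst d * B) univ_mem
    (Eventually.of_forall fun t => (hFm t).aestronglyMeasurable)
    ((hFm 0).integrable_of_hasCompactSupport (HasCompactSupport.of_compactSpace _))
    hF'm.aestronglyMeasurable
    (Eventually.of_forall fun x t _ => by
      simp only [hF', norm_mul, RCLike.norm_conj, fourierMode_eq, norm_character,
        Complex.norm_real, mul_one]
      rw [Real.norm_of_nonneg (modeConst_pos d).le]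
      exact mul_le_mul_of_nonneg_left (hB _ (Set.mem_univ _)) (modeConst_pos d).le)
    (integrable_const _)
    (Eventually.of_forall fun x t _ =>
      ((hφ.hasDerivAt_add_single r x t).ofReal_comp).const_mul _)).2
  have hint : ∀ t : ℝ, ∫ x, F t x =
      Complex.exp (Complex.I * k r * t) * scalarCoeff (fun x => (φ x : ℂ)) k := by
    intro t
    rw [← integral_sub_right_eq_self _
      (Pi.single r (t : AddCircle (2 * Real.pi)) : Torus d), scalarCoeff, ← integral_const_mul]
    refine integral_congr_ae (Eventually.of_forall fun x => ?_)
    have hc : character k x = character k (x - Pi.single r (t : AddCircle (2 * Real.pi))) *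
        Complex.exp (Complex.I * k r * t) := by
      rw [← character_add_single, sub_add_cancel]
    have he : Complex.exp (Complex.I * k r * t) * conj (Complex.exp (Complex.I * k r * t)) = 1 := by
      rw [← Complex.exp_conj, ← Complex.exp_add]
      simp
    simp only [hF, sub_add_cancel, fourierMode_eq, hc, map_mul]
    linear_combination (-(conj (modeConst d : ℂ)) *
      conj (character k (x - Pi.single r (t : AddCircle (2 * Real.pi)))) * (φ x : ℂ)) * he
  have hexp : HasDerivAt (fun t : ℝ => Complex.exp (Complex.I * k r * t) *
      scalarCoeff (fun x => (φ x : ℂ)) k)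
      (Complex.I * k r * scalarCoeff (fun x => (φ x : ℂ)) k) 0 := by
    have h1 : HasDerivAt (fun t : ℝ => Complex.I * k r * (t : ℂ)) (Complex.I * k r) 0 := by
      simpa using (Complex.ofRealCLM.hasDerivAt (x := (0 : ℝ))).const_mul (Complex.I * k r)
    have h2 := (h1.cexp).mul_const (scalarCoeff (fun x => (φ x : ℂ)) k)
    simpa using h2
  simp only [hint] at hder
  have := hder.unique hexp
  simpa [hF', scalarCoeff] using this

lemma integrable_smul_field {f : Torus d → ℝ} (hf : Continuous f) {g : Field d}
    (hg : MemLp g 2 volume) : Integrable (fun x => f x • g x) volume := by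
  refine Integrable.of_eval_piLp fun s => ?_
  have h1 : MemLp f 2 volume :=
    hf.memLp_of_hasCompactSupport (HasCompactSupport.of_compactSpace f)
  exact h1.integrable_mul (MemLp.eval_piLp hg s)

lemma integral_smul_field_apply {f : Torus d → ℝ} (hf : Continuous f) {g : Field d}
    (hg : MemLp g 2 volume) (s : Fin d) :
    (∫ x, f x • g x) s = ∫ x, f x * g x s := by
  rw [eval_integral_piLp fun i => (integrable_smul_field hf hg).eval_piLp i]
  rfl

/-- A square integrable field with the Fourier coefficients `i k_r w_k` is the distributional
derivative of `w`, by Parseval's identity. -/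
lemma isWeakPartial_of_coeff {w g : Field d} (hw : MemLp w 2 volume) (hg : MemLp g 2 volume)
    {r : Fin d} (h : ∀ k, coeff g k = (Complex.I * k r) • coeff w k) : IsWeakPartial r w g := by
  intro φ hφ
  ext s
  rw [PiLp.neg_apply, integral_smul_field_apply hφ.continuous hg,
    integral_smul_field_apply (hφ.continuous_classicalPartial r) hw]
  have h1 := hasSum_scalarCoeff (memLp_of_continuous hφ.continuous) (memLp_component hg s)
  have h2 := hasSum_scalarCoeff (memLp_of_continuous (hφ.continuous_classicalPartial r))
    (memLp_component hw s)
  have h3 := h2.neg.unique (h1.congr_fun fun k => by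
    have := congrArg (fun c : EuclideanSpace ℂ (Fin d) => c s) (h k)
    simp only [PiLp.smul_apply, coeff_apply, smul_eq_mul] at this
    rw [this, hφ.scalarCoeff_classicalPartial]
    simp only [map_mul, Complex.conj_I, map_intCast]
    ring)
  simp only [Complex.conj_ofReal, ← Complex.ofReal_mul, integral_complex_ofReal] at h3
  exact_mod_cast h3.symm

lemma contDiff_character (k : Fin d → ℤ) :
    ContDiff ℝ ∞ fun y : Fin d → ℝ => character k (toTorus y) := by
  simp only [character_apply, toTorus, fourier_coe_two_pi]
  refine contDiff_prod fun r _ => ?_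
  have h : ContDiff ℝ ∞ fun y : Fin d → ℝ => ((y r : ℝ) : ℂ) :=
    Complex.ofRealCLM.contDiff.comp (contDiff_apply ℝ ℝ r)
  exact (contDiff_const.mul h).cexp

lemma hasDerivAt_character (k : Fin d → ℤ) (r : Fin d) (x : Torus d) :
    HasDerivAt (fun t : ℝ => character k (Function.update x r (x r + (t : AddCircle _))))
      (Complex.I * k r * character k x) 0 := by
  simp only [update_eq_add_single, character_add_single]
  have h1 : HasDerivAt (fun t : ℝ => Complex.I * k r * (t : ℂ)) (Complex.I * k r) 0 := by
    simpa using (Complex.ofRealCLM.hasDerivAt (x := (0 : ℝ))).const_mul (Complex.I * k r)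
  simpa [mul_comm] using (h1.cexp).const_mul (character k x)

lemma classicalPartial_re_character (k : Fin d → ℤ) (r : Fin d) (x : Torus d) :
    classicalPartial r (fun x => (character k x).re) x = -(k r * (character k x).im) := by
  have h := (Complex.reCLM.hasFDerivAt.comp_hasDerivAt _ (hasDerivAt_character k r x)).deriv
  simpa [classicalPartial, Function.comp_def] using! h

lemma classicalPartial_im_character (k : Fin d → ℤ) (r : Fin d) (x : Torus d) :
    classicalPartial r (fun x => (character k x).im) x = k r * (character k x).re := by
  have h := (Complex.imCLM.hasFDerivAt.comp_hasDerivAt _ (hasDerivAt_character k r x)).deriv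
  simpa [classicalPartial, Function.comp_def] using! h

/-- The components of a Fourier coefficient are computed with the real and imaginary parts of the
character, which are admissible test functions. -/
lemma coeff_apply_eq_re_im {g : Field d} (hg : MemLp g 2 volume) (k : Fin d → ℤ) (s : Fin d) :
    coeff g k s = (modeConst d : ℂ) * ((∫ x, (character k x).re * g x s : ℝ) -
      Complex.I * (∫ x, (character k x).im * g x s : ℝ)) := by
  have hi : ∀ f : Torus d → ℝ, Continuous f → Integrable fun x => f x * g x s := fun f hf =>
    (hf.memLp_of_hasCompactSupport (p := 2) (HasCompactSupport.of_compactSpace f)).integrable_mul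
      (MemLp.eval_piLp hg s)
  have hre : Integrable fun x => (((character k x).re * g x s : ℝ) : ℂ) :=
    (hi (fun x => (character k x).re)
    (Complex.continuous_re.comp (character k).continuous)).ofReal
  have him : Integrable fun x => (((character k x).im * g x s : ℝ) : ℂ) :=
    (hi (fun x => (character k x).im)
    (Complex.continuous_im.comp (character k).continuous)).ofReal
  rw [← integral_complex_ofReal, ← integral_complex_ofReal, ← integral_const_mul,
    ← integral_sub hre (him.const_mul _), ← integral_const_mul, coeff_apply, scalarCoeff]
  refine integral_congr_ae (Eventually.of_forall fun x => ?_)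
  have hc : conj (character k x) = ((character k x).re : ℂ) - Complex.I * (character k x).im := by
    apply Complex.ext <;> simp
  simp only [fourierMode_eq, map_mul, Complex.conj_ofReal, hc]
  push_cast
  ring

lemma coeff_of_isWeakPartial {w g : Field d} (hw : MemLp w 2 volume) (hg : MemLp g 2 volume)
    {r : Fin d} (h : IsWeakPartial r w g) (k : Fin d → ℤ) :
    coeff g k = (Complex.I * k r) • coeff w k := by
  ext s
  have hre : IsSmooth fun x : Torus d => (character k x).re :=
    Complex.reCLM.contDiff.comp (contDiff_character k)
  have him : IsSmooth fun x : Torus d => (character k x).im :=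
    Complex.imCLM.contDiff.comp (contDiff_character k)
  have h1 := congrArg (fun c : EuclideanSpace ℝ (Fin d) => c s) (h _ hre)
  have h2 := congrArg (fun c : EuclideanSpace ℝ (Fin d) => c s) (h _ him)
  simp only [PiLp.neg_apply] at h1 h2
  rw [integral_smul_field_apply hre.continuous hg,
    integral_smul_field_apply (hre.continuous_classicalPartial r) hw] at h1
  rw [integral_smul_field_apply him.continuous hg,
    integral_smul_field_apply (him.continuous_classicalPartial r) hw] at h2
  simp only [classicalPartial_re_character, neg_mul, mul_assoc, integral_neg,
    integral_const_mul, neg_neg] at h1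
  simp only [classicalPartial_im_character, mul_assoc, integral_const_mul] at h2
  rw [PiLp.smul_apply, coeff_apply_eq_re_im hg, coeff_apply_eq_re_im hw, h1, h2]
  push_cast
  simp only [smul_eq_mul]
  linear_combination ((k r : ℂ) * (modeConst d : ℂ) *
    ((∫ x, (character k x).im * w x s : ℝ) : ℂ)) * Complex.I_sq

/-- If `∑ |k_r|² |w_k|²` converges, then `∂_r w` is square integrable with coefficients
`i k_r w_k`. -/
lemma weakPartial_spec {w : Field d} (hw : MemLp w 2 volume) (r : Fin d)
    (hs : Summable fun k : Fin d → ℤ => (k r : ℝ) ^ 2 * ‖coeff w k‖ ^ 2) :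
    MemLp (weakPartial r w) 2 volume ∧
      ∀ k, coeff (weakPartial r w) k = (Complex.I * k r) • coeff w k := by
  have hex : ∃ g : Field d, MemLp g 2 volume ∧ IsWeakPartial r w g := by
    obtain ⟨g, hg, hgc⟩ := exists_field_coeff_eq
      (c := fun k : Fin d → ℤ => (Complex.I * k r) • coeff w k)
      (hs.congr fun k => by simp [norm_smul, mul_pow])
      (fun k s => by simp [coeff_neg])
    exact ⟨g, hg, isWeakPartial_of_coeff hw hg hgc⟩
  rw [weakPartial, dif_pos hex]
  exact ⟨hex.choose_spec.1, coeff_of_isWeakPartial hw hex.choose_spec.1 hex.choose_spec.2⟩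

/-! ### The bilinear map on the Fourier side -/

/-- The Fourier coefficients of a product are the convolution of the Fourier coefficients. -/
lemma hasSum_scalarCoeff_mul {f : Torus d → ℝ} {g : Torus d → ℂ}
    (hf : MemLp (fun x => (f x : ℂ)) 2 volume) (hg : MemLp g 2 volume) (k : Fin d → ℤ) :
    HasSum (fun l => (modeConst d : ℂ) * (scalarCoeff (fun x => (f x : ℂ)) (k - l) *
      scalarCoeff g l)) (scalarCoeff (fun x => (f x : ℂ) * g x) k) := by
  -- Parseval's identity for `f e_k` and `g`: the coefficients of `f e_k` are shifted ones of `f`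
  have hfe : MemLp (fun x => fourierMode k x * (f x : ℂ)) 2 volume := by
    refine (hf.const_mul (modeConst d : ℂ)).of_le
      ((continuous_fourierMode k).aestronglyMeasurable.mul hf.1)
      (Eventually.of_forall fun x => ?_)
    simp [fourierMode_eq, norm_character]
  have h := hasSum_scalarCoeff hfe hg
  have h2 : ∫ x, conj (fourierMode k x * (f x : ℂ)) * g x =
      scalarCoeff (fun x => (f x : ℂ) * g x) k := by
    rw [scalarCoeff]
    simp [mul_assoc]
  rw [h2] at h
  refine h.congr_fun fun l => ?_
  have h3 : scalarCoeff (fun x => fourierMode k x * (f x : ℂ)) l =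
      (modeConst d : ℂ) * scalarCoeff (fun x => (f x : ℂ)) (l - k) := by
    rw [scalarCoeff, scalarCoeff, ← integral_const_mul]
    refine integral_congr_ae (Eventually.of_forall fun x => ?_)
    simp only
    rw [← mul_assoc, conj_fourierMode_mul, mul_assoc]
  rw [h3, map_mul, Complex.conj_ofReal, ← scalarCoeff_neg_of_real, neg_sub, mul_assoc]

lemma hasSum_coeff_advection {v w : Field d} (hv : MemLp v 2 volume) (hw : MemLp w 2 volume)
    (hs : ∀ r, Summable fun k : Fin d → ℤ => (k r : ℝ) ^ 2 * ‖coeff w k‖ ^ 2)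
    (k : Fin d → ℤ) (s : Fin d) :
    HasSum (fun l => (modeConst d : ℂ) * (Complex.I * latticeDot l (coeff v (k - l)) *
      coeff w l s)) (coeff (advection v w) k s) := by
  have hp := fun r => weakPartial_spec hw r (hs r)
  have h1 : coeff (advection v w) k s = ∑ r, scalarCoeff
      (fun x => ((v x r : ℝ) : ℂ) * ((weakPartial r w x s : ℝ) : ℂ)) k := by
    simp only [scalarCoeff]
    rw [← integral_finsetSum]
    · rw [coeff_apply, scalarCoeff]
      refine integral_congr_ae (Eventually.of_forall fun x => ?_)
      simp [advection, Finset.mul_sum]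
    · intro r _
      have hb : Integrable fun x => ((v x r : ℝ) : ℂ) * ((weakPartial r w x s : ℝ) : ℂ) :=
        (memLp_component hv r).integrable_mul (memLp_component (hp r).1 s)
      refine (hb.norm.const_mul (modeConst d)).mono'
        ((Complex.continuous_conj.comp (continuous_fourierMode k)).aestronglyMeasurable.mul hb.1)
        (Eventually.of_forall fun x => ?_)
      simp [fourierMode_eq, norm_character, abs_of_pos (modeConst_pos d)]
  rw [h1]
  have h2 := hasSum_sum (s := Finset.univ) fun r _ =>
    hasSum_scalarCoeff_mul (memLp_component hv r) (memLp_component (hp r).1 s) k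
  refine h2.congr_fun fun l => ?_
  rw [latticeDot, Finset.mul_sum, Finset.sum_mul, Finset.mul_sum]
  refine Finset.sum_congr rfl fun r _ => ?_
  rw [← coeff_apply, ← coeff_apply, (hp r).2 l, PiLp.smul_apply, smul_eq_mul]
  ring

end

section

/-! ### Convolution inequalities for square summable families -/

section Convolution

variable {ι : Type*}

lemma summable_mul_of_sq {f g : ι → ℝ} (hf : Summable fun i => f i ^ 2)
    (hg : Summable fun i => g i ^ 2) : Summable fun i => f i * g i := by
  refine Summable.of_norm_bounded (hf.add hg) fun i => ?_
  rw [Real.norm_eq_abs, abs_le]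
  constructor <;> nlinarith [sq_nonneg (f i - g i), sq_nonneg (f i + g i), sq_nonneg (f i),
    sq_nonneg (g i)]

/-- The Cauchy–Schwarz inequality for series. -/
lemma tsum_mul_le_sqrt_mul_sqrt {f g : ι → ℝ} (hf : Summable fun i => f i ^ 2)
    (hg : Summable fun i => g i ^ 2) :
    ∑' i, f i * g i ≤ Real.sqrt (∑' i, f i ^ 2) * Real.sqrt (∑' i, g i ^ 2) := by
  refine (summable_mul_of_sq hf hg).tsum_le_of_sum_le fun s => ?_
  refine (Real.sum_mul_le_sqrt_mul_sqrt s f g).trans ?_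
  gcongr
  · exact hf.sum_le_tsum s fun i _ => sq_nonneg _
  · exact hg.sum_le_tsum s fun i _ => sq_nonneg _

variable {G : Type*} [AddCommGroup G]

/-- The change of variables `(h, l) ↦ (h + l, l)`. -/
def shearEquiv (G : Type*) [AddCommGroup G] : G × G ≃ G × G where
  toFun x := (x.1 + x.2, x.2)
  invFun x := (x.1 - x.2, x.2)
  left_inv x := by simp
  right_inv x := by simp

/-- The change of variables `(k, l) ↦ (k, k - l)`. -/
def reflectEquiv (G : Type*) [AddCommGroup G] : G × G ≃ G × G where
  toFun x := (x.1, x.1 - x.2)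
  invFun x := (x.1, x.1 - x.2)
  left_inv x := by simp
  right_inv x := by simp

/-- Young's inequality `ℓ¹ * ℓ² ⊆ ℓ²`, tested against a third family in `ℓ²`. -/
lemma young_trilinear {a b c : G → ℝ} (ha0 : ∀ i, 0 ≤ a i) (hb0 : ∀ i, 0 ≤ b i)
    (hc0 : ∀ i, 0 ≤ c i) (ha : Summable a) (hb : Summable fun i => b i ^ 2)
    (hc : Summable fun i => c i ^ 2) :
    Summable (fun x : G × G => a (x.1 - x.2) * b x.2 * c x.1) ∧
      ∑' x : G × G, a (x.1 - x.2) * b x.2 * c x.1 ≤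
        (∑' i, a i) * (Real.sqrt (∑' i, b i ^ 2) * Real.sqrt (∑' i, c i ^ 2)) := by
  have hcs : ∀ h : G, Summable fun l => c (h + l) ^ 2 := fun h =>
    (Equiv.addLeft h).summable_iff (f := fun l => c l ^ 2) |>.mpr hc
  have hct : ∀ h : G, ∑' l, c (h + l) ^ 2 = ∑' l, c l ^ 2 := fun h =>
    (Equiv.addLeft h).tsum_eq (fun l => c l ^ 2)
  have hle : ∀ h : G, ∑' l, a h * (b l * c (h + l)) ≤
      a h * (Real.sqrt (∑' i, b i ^ 2) * Real.sqrt (∑' i, c i ^ 2)) := fun h => by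
    rw [tsum_mul_left, ← hct h]
    exact mul_le_mul_of_nonneg_left (tsum_mul_le_sqrt_mul_sqrt hb (hcs h)) (ha0 h)
  have h0 : ∀ x : G × G, 0 ≤ a x.1 * (b x.2 * c (x.1 + x.2)) := fun x =>
    mul_nonneg (ha0 _) (mul_nonneg (hb0 _) (hc0 _))
  have hinner : ∀ h : G, Summable fun l => a h * (b l * c (h + l)) := fun h =>
    (summable_mul_of_sq hb (hcs h)).mul_left _
  have houter : Summable fun h => ∑' l, a h * (b l * c (h + l)) :=
    (ha.mul_right _).of_nonneg_of_le (fun h => tsum_nonneg fun l => h0 (h, l)) hle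
  have hsum : Summable fun x : G × G => a x.1 * (b x.2 * c (x.1 + x.2)) :=
    (summable_prod_of_nonneg h0).mpr ⟨hinner, houter⟩
  have hcomp : (fun x : G × G => a (x.1 - x.2) * b x.2 * c x.1) ∘ shearEquiv G =
      fun x : G × G => a x.1 * (b x.2 * c (x.1 + x.2)) := by
    funext x
    simp [shearEquiv, mul_assoc]
  constructor
  · rw [← (shearEquiv G).summable_iff, hcomp]
    exact hsum
  · rw [← (shearEquiv G).tsum_eq]
    change ∑' x, ((fun x : G × G => a (x.1 - x.2) * b x.2 * c x.1) ∘ shearEquiv G) x ≤ _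
    rw [hcomp, hsum.tsum_prod' hinner, ← tsum_mul_right]
    exact houter.tsum_le_tsum hle (ha.mul_right _)

/-- The variant of `young_trilinear` in which the second family is the summable one. -/
lemma young_trilinear' {a b c : G → ℝ} (ha0 : ∀ i, 0 ≤ a i) (hb0 : ∀ i, 0 ≤ b i)
    (hc0 : ∀ i, 0 ≤ c i) (ha : Summable fun i => a i ^ 2) (hb : Summable b)
    (hc : Summable fun i => c i ^ 2) :
    Summable (fun x : G × G => a (x.1 - x.2) * b x.2 * c x.1) ∧
      ∑' x : G × G, a (x.1 - x.2) * b x.2 * c x.1 ≤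
        (∑' i, b i) * (Real.sqrt (∑' i, a i ^ 2) * Real.sqrt (∑' i, c i ^ 2)) := by
  have h := young_trilinear hb0 ha0 hc0 hb ha hc
  have hcomp : (fun x : G × G => b (x.1 - x.2) * a x.2 * c x.1) ∘ reflectEquiv G =
      fun x : G × G => a (x.1 - x.2) * b x.2 * c x.1 := by
    funext x
    simp [reflectEquiv, mul_comm]
  rw [← (reflectEquiv G).summable_iff, ← (reflectEquiv G).tsum_eq] at h
  change Summable ((fun x : G × G => b (x.1 - x.2) * a x.2 * c x.1) ∘ reflectEquiv G) ∧
    ∑' x, ((fun x : G × G => b (x.1 - x.2) * a x.2 * c x.1) ∘ reflectEquiv G) x ≤ _ at h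
  rwa [hcomp] at h

/-- Young's inequality `ℓ¹ * ℓ² ⊆ ℓ²`. -/
lemma summable_conv_sq {a b : G → ℝ} (ha0 : ∀ i, 0 ≤ a i) (ha : Summable a)
    (hb : Summable fun i => b i ^ 2) :
    (∀ k, Summable fun l => a (k - l) * b l) ∧
      Summable fun k => (∑' l, a (k - l) * b l) ^ 2 := by
  -- Cauchy–Schwarz with the factors `√a` and `√a b`
  have hak : ∀ k, Summable fun l => a (k - l) := fun k => (Equiv.subLeft k).summable_iff.mpr ha
  have hakt : ∀ k, ∑' l, a (k - l) = ∑' l, a l := fun k => (Equiv.subLeft k).tsum_eq a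
  have hprod : Summable fun x : G × G => a (x.1 - x.2) * b x.2 ^ 2 := by
    rw [← (shearEquiv G).summable_iff]
    have hcomp : (fun x : G × G => a (x.1 - x.2) * b x.2 ^ 2) ∘ shearEquiv G =
        fun x : G × G => a x.1 * b x.2 ^ 2 := by
      funext x
      simp [shearEquiv]
    rw [hcomp]
    exact ha.mul_of_nonneg hb ha0 fun i => sq_nonneg _
  have hf : ∀ k, Summable fun l => Real.sqrt (a (k - l)) ^ 2 := fun k =>
    (hak k).congr fun l => (Real.sq_sqrt (ha0 _)).symm
  have hg : ∀ k, Summable fun l => (Real.sqrt (a (k - l)) * b l) ^ 2 := fun k =>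
    (hprod.prod_factor k).congr fun l => by rw [mul_pow, Real.sq_sqrt (ha0 _)]
  have hg' : ∀ k, Summable fun l => (Real.sqrt (a (k - l)) * |b l|) ^ 2 := fun k =>
    (hg k).congr fun l => by rw [mul_pow, mul_pow, sq_abs]
  have hs : ∀ k, Summable fun l => a (k - l) * b l := fun k =>
    (summable_mul_of_sq (hf k) (hg k)).congr fun l => by
      rw [← mul_assoc, Real.mul_self_sqrt (ha0 _)]
  refine ⟨hs, ?_⟩
  refine (hprod.prod.mul_left (∑' l, a l)).of_nonneg_of_le (fun k => sq_nonneg _) fun k => ?_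
  have h1 : |∑' l, a (k - l) * b l| ≤ Real.sqrt (∑' l, a l) *
      Real.sqrt (∑' l, a (k - l) * b l ^ 2) := by
    rw [← Real.norm_eq_abs]
    refine (norm_tsum_le_tsum_norm (hs k).norm).trans ?_
    have h2 := tsum_mul_le_sqrt_mul_sqrt (hf k) (hg' k)
    simp only [mul_pow, Real.sq_sqrt (ha0 _), sq_abs, hakt, ← mul_assoc,
      Real.mul_self_sqrt (ha0 _)] at h2
    simpa [abs_of_nonneg (ha0 _)] using h2
  rw [← sq_abs]
  refine (pow_le_pow_left₀ (abs_nonneg _) h1 2).trans_eq ?_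
  rw [mul_pow, Real.sq_sqrt (tsum_nonneg ha0),
    Real.sq_sqrt (tsum_nonneg fun l => mul_nonneg (ha0 _) (sq_nonneg _))]

lemma summable_conv_sq' {a b : G → ℝ} (hb0 : ∀ i, 0 ≤ b i) (hb : Summable b)
    (ha : Summable fun i => a i ^ 2) :
    (∀ k, Summable fun l => a (k - l) * b l) ∧
      Summable fun k => (∑' l, a (k - l) * b l) ^ 2 := by
  have h := summable_conv_sq hb0 hb ha
  have hcomp : ∀ k, (fun l => b (k - l) * a l) ∘ Equiv.subLeft k = fun l => a (k - l) * b l := by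
    intro k
    funext l
    simp [mul_comm]
  refine ⟨fun k => ?_, h.2.congr fun k => ?_⟩
  · rw [← hcomp]
    exact (Equiv.subLeft k).summable_iff.mpr (h.1 k)
  · rw [← hcomp, ← (Equiv.subLeft k).tsum_eq (fun l => b (k - l) * a l)]
    rfl

end Convolution

/-! ### The lattice -/

variable {d : ℕ}

/-- A lattice point as a vector of `ℂ^d`. -/
noncomputable def latticeVec (k : Fin d → ℤ) : EuclideanSpace ℂ (Fin d) :=
  WithLp.toLp 2 fun s => (k s : ℂ)

lemma norm_latticeVec (k : Fin d → ℤ) : ‖latticeVec k‖ = latticeNorm k := by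
  simp [EuclideanSpace.norm_eq, latticeVec, latticeNorm]

lemma latticeDot_eq_inner (k : Fin d → ℤ) (c : EuclideanSpace ℂ (Fin d)) :
    latticeDot k c = inner ℂ (latticeVec k) c := by
  simp [PiLp.inner_apply, latticeVec, latticeDot, mul_comm]

lemma latticeNorm_nonneg (k : Fin d → ℤ) : 0 ≤ latticeNorm k := Real.sqrt_nonneg _

lemma latticeNorm_neg (k : Fin d → ℤ) : latticeNorm (-k) = latticeNorm k := by
  simp [latticeNorm]

lemma latticeVec_sub (j k : Fin d → ℤ) : latticeVec (j - k) = latticeVec j - latticeVec k := by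
  ext s
  simp [latticeVec]

lemma abs_latticeNorm_sub_le (k l : Fin d → ℤ) :
    |latticeNorm k - latticeNorm l| ≤ latticeNorm (k - l) := by
  simp only [← norm_latticeVec, latticeVec_sub]
  exact abs_norm_sub_norm_le _ _

lemma latticeNorm_le_add (k l : Fin d → ℤ) :
    latticeNorm k ≤ latticeNorm (k - l) + latticeNorm l := by
  have := (abs_le.mp (abs_latticeNorm_sub_le k l)).2
  linarith

lemma one_le_latticeNorm {k : Fin d → ℤ} (hk : k ≠ 0) : 1 ≤ latticeNorm k := by
  obtain ⟨i, hi⟩ := Function.ne_iff.mp hk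
  rw [latticeNorm, Real.one_le_sqrt]
  have h1 : (1 : ℝ) ≤ (k i : ℝ) ^ 2 := by
    have : 1 ≤ (k i) ^ 2 := by
      have h0 : k i ≠ 0 := hi
      have : 0 < (k i) ^ 2 := by positivity
      exact this
    exact_mod_cast this
  exact h1.trans (Finset.single_le_sum (f := fun r => (k r : ℝ) ^ 2)
    (fun r _ => sq_nonneg _) (Finset.mem_univ i))

lemma norm_latticeDot_le (k : Fin d → ℤ) (c : EuclideanSpace ℂ (Fin d)) :
    ‖latticeDot k c‖ ≤ latticeNorm k * ‖c‖ := by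
  rw [latticeDot_eq_inner, ← norm_latticeVec]
  exact norm_inner_le_norm _ _

lemma latticeDot_sub (k l : Fin d → ℤ) (c : EuclideanSpace ℂ (Fin d)) :
    latticeDot (k - l) c = latticeDot k c - latticeDot l c := by
  rw [latticeDot_eq_inner, latticeVec_sub, inner_sub_left, ← latticeDot_eq_inner,
    ← latticeDot_eq_inner]

lemma latticeDot_neg (k : Fin d → ℤ) (c : EuclideanSpace ℂ (Fin d)) :
    latticeDot (-k) c = -latticeDot k c := by
  simp [latticeDot]

/-- `∑ |k|^(-r)` converges over `ℤ^d` for `r > d`. -/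
lemma summable_latticeNorm_rpow {r : ℝ} (hr : r < -(d : ℝ)) :
    Summable fun k : Fin d → ℤ => latticeNorm k ^ r := by
  set b := (EuclideanSpace.basisFun (Fin d) ℝ).toBasis with hb
  set L := Submodule.span ℤ (Set.range b) with hL
  -- the sum is compared with the one over the lattice spanned by the standard basis of `ℝ^d`
  have hrank : Module.finrank ℤ L = d := by
    rw [hL, ZLattice.rank ℝ]
    simp
  have hsum := ZLattice.summable_norm_rpow L r (by rwa [hrank])
  set f : (Fin d → ℤ) → L := fun k => ∑ i, k i • ⟨b i, Submodule.subset_span ⟨i, rfl⟩⟩ with hf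
  have hfa : ∀ k i, (f k : EuclideanSpace ℝ (Fin d)) i = k i := by
    intro k i
    simp [hf, hb, Finset.sum_apply, Pi.single_apply]
  have hinj : Function.Injective f := by
    intro k k' h
    funext i
    have := congrArg (fun x : L => (x : EuclideanSpace ℝ (Fin d)) i) h
    simp only [hfa] at this
    exact_mod_cast this
  refine (hsum.comp_injective hinj).congr fun k => ?_
  have : ‖f k‖ = latticeNorm k := by
    rw [Submodule.coe_norm, EuclideanSpace.norm_eq, latticeNorm]
    simp [hfa]
  rw [Function.comp_apply, this]

/-! ### Sobolev norms on the Fourier side -/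

/-- The size `|k|^m |v_k|` of the `k`-th Fourier coefficient, as measured in `H^m`. -/
noncomputable def sobolevCoeff (m : ℝ) (v : Field d) (k : Fin d → ℤ) : ℝ :=
  latticeNorm k ^ m * ‖coeff v k‖

lemma sobolevCoeff_nonneg (m : ℝ) (v : Field d) (k : Fin d → ℤ) : 0 ≤ sobolevCoeff m v k :=
  mul_nonneg (Real.rpow_nonneg (latticeNorm_nonneg k) m) (norm_nonneg _)

lemma sobolevCoeff_sq (m : ℝ) (v : Field d) (k : Fin d → ℤ) :
    sobolevCoeff m v k ^ 2 = latticeNorm k ^ (2 * m) * ‖coeff v k‖ ^ 2 := by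
  rw [sobolevCoeff, mul_pow, mul_comm 2 m, Real.rpow_mul (latticeNorm_nonneg k)]
  norm_cast

lemma sobolevCoeff_eq_zero {m : ℝ} {v : Field d} {k : Fin d → ℤ} (h : coeff v k = 0) :
    sobolevCoeff m v k = 0 := by
  simp [sobolevCoeff, h]

lemma summable_subtype_ne_zero_iff {E : Type*} [AddCommGroup E] [TopologicalSpace E]
    {f : (Fin d → ℤ) → E} (h : f 0 = 0) :
    (Summable fun k : {k : Fin d → ℤ // k ≠ 0} => f k.1) ↔ Summable f := by
  refine (Function.Injective.summable_iff Subtype.val_injective fun k hk => ?_)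
  by_contra h1
  exact hk ⟨⟨k, fun h0 => h1 (h0 ▸ h)⟩, rfl⟩

lemma tsum_subtype_ne_zero {E : Type*} [AddCommGroup E] [TopologicalSpace E]
    {f : (Fin d → ℤ) → E} (h : f 0 = 0) :
    ∑' k : {k : Fin d → ℤ // k ≠ 0}, f k.1 = ∑' k, f k := by
  refine Subtype.val_injective.tsum_eq (f := f) fun k hk => ?_
  exact ⟨⟨k, fun h0 => hk (h0 ▸ h)⟩, rfl⟩

lemma MemSobolev.summable_sobolevCoeff_sq {m : ℝ} {v : Field d} (hv : MemSobolev m v) :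
    Summable fun k => sobolevCoeff m v k ^ 2 := by
  rw [← summable_subtype_ne_zero_iff (by simp [sobolevCoeff_eq_zero hv.mean_zero])]
  exact hv.summable.congr fun k => (sobolevCoeff_sq m v k).symm

lemma sobolevCoeff_mono {m m' : ℝ} (h : m ≤ m') {v : Field d} (hv : coeff v 0 = 0)
    (k : Fin d → ℤ) : sobolevCoeff m v k ≤ sobolevCoeff m' v k := by
  by_cases hk : k = 0
  · rw [hk, sobolevCoeff_eq_zero hv, sobolevCoeff_eq_zero hv]
  · exact mul_le_mul_of_nonneg_right
      (Real.rpow_le_rpow_of_exponent_le (one_le_latticeNorm hk) h) (norm_nonneg _)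

lemma MemSobolev.mono {m m' : ℝ} (h : m ≤ m') {v : Field d} (hv : MemSobolev m' v) :
    MemSobolev m v where
  memLp := hv.memLp
  div_free := hv.div_free
  mean_zero := hv.mean_zero
  summable := hv.summable.of_nonneg_of_le
    (fun k => by rw [← sobolevCoeff_sq]; positivity) fun k => by
      rw [← sobolevCoeff_sq, ← sobolevCoeff_sq]
      exact pow_le_pow_left₀ (sobolevCoeff_nonneg _ _ _) (sobolevCoeff_mono h hv.mean_zero _) 2

lemma sum_conj_mul_eq_inner (x y : EuclideanSpace ℂ (Fin d)) :
    ∑ s, conj (x s) * y s = inner ℂ x y := by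
  simp [PiLp.inner_apply, mul_comm]

lemma sobolevInner_eq (m : ℝ) {v w : Field d} (hw : coeff w 0 = 0) :
    sobolevInner m v w =
      ∑' k, ((latticeNorm k ^ (2 * m) : ℝ) : ℂ) * inner ℂ (coeff v k) (coeff w k) := by
  rw [sobolevInner]
  simp only [sum_conj_mul_eq_inner]
  exact tsum_subtype_ne_zero (f := fun k : Fin d → ℤ =>
    ((latticeNorm k ^ (2 * m) : ℝ) : ℂ) * inner ℂ (coeff v k) (coeff w k)) (by simp [hw])

lemma sobolevNorm_eq (m : ℝ) {v : Field d} (hv : coeff v 0 = 0) :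
    sobolevNorm m v = Real.sqrt (∑' k, sobolevCoeff m v k ^ 2) := by
  rw [sobolevNorm, sobolevInner_eq m hv]
  have h : ∀ k, ((latticeNorm k ^ (2 * m) : ℝ) : ℂ) * inner ℂ (coeff v k) (coeff v k) =
      ((sobolevCoeff m v k ^ 2 : ℝ) : ℂ) := fun k => by
    rw [sobolevCoeff_sq, inner_self_eq_norm_sq_to_K, Complex.ofReal_mul, Complex.ofReal_pow]
    rfl
  simp only [h, ← Complex.ofReal_tsum, Complex.ofReal_re]

lemma sobolevNorm_nonneg (m : ℝ) (v : Field d) : 0 ≤ sobolevNorm m v := Real.sqrt_nonneg _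

/-- The constant of the embedding of `H^n` into the fields with `∑ |k| |v_k| < ∞`. -/
noncomputable def embeddingConst (d : ℕ) (n : ℝ) : ℝ :=
  Real.sqrt (∑' k : Fin d → ℤ, (latticeNorm k ^ (1 - n)) ^ 2)

/-- The Sobolev embedding: fields in `H^n` with `n > d/2 + 1` satisfy `∑ |k| |v_k| < ∞`. -/
lemma MemSobolev.summable_sobolevCoeff_one {n : ℝ} (hn : (d : ℝ) / 2 + 1 < n) {v : Field d}
    (hv : MemSobolev n v) : Summable (sobolevCoeff 1 v) ∧
      ∑' k, sobolevCoeff 1 v k ≤ embeddingConst d n * sobolevNorm n v := by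
  have hz : Summable fun k : Fin d → ℤ => (latticeNorm k ^ (1 - n)) ^ 2 := by
    refine (summable_latticeNorm_rpow (r := (1 - n) * 2) (by linarith)).congr fun k => ?_
    rw [Real.rpow_mul (latticeNorm_nonneg k)]
    norm_cast
  have heq : sobolevCoeff 1 v = fun k => latticeNorm k ^ (1 - n) * sobolevCoeff n v k := by
    funext k
    by_cases hk : k = 0
    · rw [hk, sobolevCoeff_eq_zero hv.mean_zero, sobolevCoeff_eq_zero hv.mean_zero, mul_zero]
    · rw [sobolevCoeff, sobolevCoeff, ← mul_assoc, ← Real.rpow_add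
        (zero_lt_one.trans_le (one_le_latticeNorm hk)), sub_add_cancel]
  rw [heq, sobolevNorm_eq n hv.mean_zero]
  exact ⟨summable_mul_of_sq hz hv.summable_sobolevCoeff_sq,
    tsum_mul_le_sqrt_mul_sqrt hz hv.summable_sobolevCoeff_sq⟩

end

section

variable {d : ℕ}

/-! ### The Leray projection -/

lemma leraySymbol_eq (k : Fin d → ℤ) (c : EuclideanSpace ℂ (Fin d)) :
    leraySymbol k c = c - (latticeDot k c / ((latticeNorm k ^ 2 : ℝ) : ℂ)) • latticeVec k := by
  ext s
  simp [leraySymbol, latticeVec]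

lemma leraySymbol_zero (c : EuclideanSpace ℂ (Fin d)) : leraySymbol 0 c = c := by
  ext s
  simp [leraySymbol]

lemma latticeDot_leraySymbol (k : Fin d → ℤ) (c : EuclideanSpace ℂ (Fin d)) :
    latticeDot k (leraySymbol k c) = 0 := by
  by_cases hk : k = 0
  · simp [hk, latticeDot]
  have h0 : ((latticeNorm k : ℝ) : ℂ) ≠ 0 := by
    exact_mod_cast (zero_lt_one.trans_le (one_le_latticeNorm hk)).ne'
  rw [leraySymbol_eq, latticeDot_eq_inner, inner_sub_right, inner_smul_right,
    inner_self_eq_norm_sq_to_K, norm_latticeVec, ← latticeDot_eq_inner]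
  push_cast
  field_simp
  simp

lemma inner_leraySymbol {k : Fin d → ℤ} {c u : EuclideanSpace ℂ (Fin d)}
    (hu : latticeDot k u = 0) : inner ℂ (leraySymbol k c) u = inner ℂ c u := by
  rw [leraySymbol_eq, inner_sub_left, inner_smul_left, ← latticeDot_eq_inner, hu]
  simp

lemma norm_leraySymbol_le (k : Fin d → ℤ) (c : EuclideanSpace ℂ (Fin d)) :
    ‖leraySymbol k c‖ ≤ ‖c‖ := by
  have h1 : ‖leraySymbol k c‖ ^ 2 ≤ ‖c‖ * ‖leraySymbol k c‖ := by
    have h2 := inner_leraySymbol (c := c) (latticeDot_leraySymbol k c)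
    rw [inner_self_eq_norm_sq_to_K] at h2
    have h3 := norm_inner_le_norm (𝕜 := ℂ) c (leraySymbol k c)
    rw [← h2] at h3
    simpa using h3
  by_contra! h
  nlinarith [norm_nonneg c]

lemma leraySymbol_neg {k : Fin d → ℤ} {c c' : EuclideanSpace ℂ (Fin d)}
    (h : ∀ s, c' s = conj (c s)) (s : Fin d) :
    leraySymbol (-k) c' s = conj (leraySymbol k c s) := by
  have h1 : latticeDot (-k) c' = -conj (latticeDot k c) := by
    simp [latticeDot, h]
  simp [leraySymbol, h1, h, latticeNorm_neg]
  ring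

/-! ### Fourier coefficients of the bilinear map -/

/-- The contribution of the modes `k - l` of `v` and `l` of `w` to the `k`-th Fourier coefficient
of `v · ∂w`. -/
noncomputable def advectionTerm (v w : Field d) (k l : Fin d → ℤ) : EuclideanSpace ℂ (Fin d) :=
  ((modeConst d : ℂ) * (Complex.I * latticeDot l (coeff v (k - l)))) • coeff w l

lemma latticeNorm_sq (k : Fin d → ℤ) : latticeNorm k ^ 2 = ∑ r, (k r : ℝ) ^ 2 :=
  Real.sq_sqrt (Finset.sum_nonneg fun _ _ => sq_nonneg _)

lemma summable_sq_mul_of_memSobolev_one {w : Field d} (hw : MemSobolev 1 w) (r : Fin d) :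
    Summable fun k : Fin d → ℤ => (k r : ℝ) ^ 2 * ‖coeff w k‖ ^ 2 := by
  refine hw.summable_sobolevCoeff_sq.of_nonneg_of_le (fun k => by positivity) fun k => ?_
  rw [sobolevCoeff, Real.rpow_one, mul_pow]
  refine mul_le_mul_of_nonneg_right ?_ (sq_nonneg _)
  rw [latticeNorm_sq]
  exact Finset.single_le_sum (f := fun r => (k r : ℝ) ^ 2) (fun r _ => sq_nonneg _)
    (Finset.mem_univ r)

lemma hasSum_advectionTerm {v w : Field d} (hv : MemLp v 2 volume) (hw : MemSobolev 1 w)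
    (k : Fin d → ℤ) : HasSum (advectionTerm v w k) (coeff (advection v w) k) := by
  have h : HasSum (fun l s => advectionTerm v w k l s) (fun s => coeff (advection v w) k s) := by
    refine Pi.hasSum.mpr fun s => ?_
    refine (hasSum_coeff_advection hv hw.memLp (summable_sq_mul_of_memSobolev_one hw)
      k s).congr_fun fun l => ?_
    simp [advectionTerm, mul_assoc]
  exact (EuclideanSpace.equiv (Fin d) ℂ).symm.toContinuousLinearMap.hasSum h

lemma norm_advectionTerm_le (v w : Field d) (k l : Fin d → ℤ) :
    ‖advectionTerm v w k l‖ ≤ modeConst d * (sobolevCoeff 0 v (k - l) * sobolevCoeff 1 w l) := by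
  rw [advectionTerm, norm_smul, norm_mul, norm_mul, Complex.norm_I, Complex.norm_real,
    Real.norm_of_nonneg (modeConst_pos d).le, one_mul, sobolevCoeff, sobolevCoeff,
    Real.rpow_zero, one_mul, Real.rpow_one, mul_assoc]
  refine mul_le_mul_of_nonneg_left ?_ (modeConst_pos d).le
  calc _ ≤ (latticeNorm l * ‖coeff v (k - l)‖) * ‖coeff w l‖ := by
        gcongr
        exact norm_latticeDot_le _ _
    _ = _ := by ring

lemma rpow_mul_self {x p : ℝ} (hx : 0 ≤ x) (hp : p + 1 ≠ 0) : x ^ p * x = x ^ (p + 1) :=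
  (Real.rpow_add_one' hx hp).symm

lemma add_rpow_le_mul_rpow_add_rpow {x y p : ℝ} (hx : 0 ≤ x) (hy : 0 ≤ y) (hp : 1 ≤ p) :
    (x + y) ^ p ≤ 2 ^ (p - 1) * (x ^ p + y ^ p) := by
  lift x to NNReal using hx
  lift y to NNReal using hy
  exact_mod_cast NNReal.rpow_add_le_mul_rpow_add_rpow x y hp

/-- The weight `|k|^p` is distributed to the two factors by `|k| ≤ |k - l| + |l|`. -/
lemma rpow_mul_norm_advectionTerm_le {p : ℝ} (hp : 1 ≤ p) (v w : Field d) (k l : Fin d → ℤ) :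
    latticeNorm k ^ p * ‖advectionTerm v w k l‖ ≤ modeConst d * 2 ^ (p - 1) *
      (sobolevCoeff p v (k - l) * sobolevCoeff 1 w l +
        sobolevCoeff 0 v (k - l) * sobolevCoeff (p + 1) w l) := by
  have h1 : latticeNorm k ^ p ≤ 2 ^ (p - 1) * (latticeNorm (k - l) ^ p + latticeNorm l ^ p) :=
    (Real.rpow_le_rpow (latticeNorm_nonneg k) (latticeNorm_le_add k l) (by linarith)).trans
      (add_rpow_le_mul_rpow_add_rpow (latticeNorm_nonneg _) (latticeNorm_nonneg _) hp)
  have h2 := norm_advectionTerm_le v w k l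
  have h3 := rpow_mul_self (latticeNorm_nonneg l) (by linarith : p + 1 ≠ 0)
  calc _ ≤ (2 ^ (p - 1) * (latticeNorm (k - l) ^ p + latticeNorm l ^ p)) *
        (modeConst d * (sobolevCoeff 0 v (k - l) * sobolevCoeff 1 w l)) :=
        mul_le_mul h1 h2 (norm_nonneg _) (by
          have := Real.rpow_nonneg (latticeNorm_nonneg (k - l)) p
          have := Real.rpow_nonneg (latticeNorm_nonneg l) p
          positivity)
    _ = _ := by
        simp only [sobolevCoeff, Real.rpow_zero, Real.rpow_one, ← h3]
        ring

section

variable {p n : ℝ} {v w : Field d}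

lemma summable_sobolevCoeff_zero (hn : (d : ℝ) / 2 + 1 < n) (hv : MemSobolev n v) :
    Summable (sobolevCoeff 0 v) :=
  (hv.summable_sobolevCoeff_one hn).1.of_nonneg_of_le (sobolevCoeff_nonneg 0 v)
    (sobolevCoeff_mono zero_le_one hv.mean_zero)

lemma summable_rpow_norm_coeff_advection (hn : (d : ℝ) / 2 + 1 < n) (hp : n ≤ p)
    (hv : MemSobolev p v) (hw : MemSobolev (p + 1) w) :
    Summable fun k => (latticeNorm k ^ p * ‖coeff (advection v w) k‖) ^ 2 := by
  have hp1 : 1 ≤ p := by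
    have : (0 : ℝ) ≤ d := Nat.cast_nonneg d
    linarith
  have hw1 : MemSobolev 1 w := hw.mono (by linarith)
  obtain ⟨hs1, hq1⟩ := summable_conv_sq' (a := sobolevCoeff p v) (b := sobolevCoeff 1 w)
    (sobolevCoeff_nonneg _ _) ((hw.mono (by linarith)).summable_sobolevCoeff_one hn).1
    hv.summable_sobolevCoeff_sq
  obtain ⟨hs2, hq2⟩ := summable_conv_sq (a := sobolevCoeff 0 v) (b := sobolevCoeff (p + 1) w)
    (sobolevCoeff_nonneg _ _) (summable_sobolevCoeff_zero hn (hv.mono hp))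
    hw.summable_sobolevCoeff_sq
  have hK : 0 ≤ modeConst d * 2 ^ (p - 1) :=
    mul_nonneg (modeConst_pos d).le (Real.rpow_nonneg (by norm_num) _)
  refine (((hq1.add hq2).mul_left 2).mul_left ((modeConst d * 2 ^ (p - 1)) ^ 2)).of_nonneg_of_le
    (fun k => sq_nonneg _) fun k => ?_
  have hsum := hasSum_advectionTerm hv.memLp hw1 k
  have hb := ((hs1 k).add (hs2 k)).mul_left (modeConst d * 2 ^ (p - 1))
  have h1 : ‖latticeNorm k ^ p • coeff (advection v w) k‖ ≤
      ∑' l, modeConst d * 2 ^ (p - 1) * (sobolevCoeff p v (k - l) * sobolevCoeff 1 w l +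
        sobolevCoeff 0 v (k - l) * sobolevCoeff (p + 1) w l) := by
    rw [← (hsum.const_smul (latticeNorm k ^ p)).tsum_eq]
    refine tsum_of_norm_bounded hb.hasSum fun l => ?_
    rw [norm_smul, Real.norm_of_nonneg (Real.rpow_nonneg (latticeNorm_nonneg k) p)]
    exact rpow_mul_norm_advectionTerm_le hp1 v w k l
  rw [norm_smul, Real.norm_of_nonneg (Real.rpow_nonneg (latticeNorm_nonneg k) p),
    tsum_mul_left, (hs1 k).tsum_add (hs2 k)] at h1
  refine (pow_le_pow_left₀ (mul_nonneg (Real.rpow_nonneg (latticeNorm_nonneg k) p)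
    (norm_nonneg _)) h1 2).trans ?_
  rw [mul_pow]
  refine mul_le_mul_of_nonneg_left ?_ (sq_nonneg _)
  exact add_sq_le

lemma coeff_advection_zero (hv : MemSobolev 0 v) (hw : MemSobolev 1 w) :
    coeff (advection v w) 0 = 0 := by
  have h := hasSum_advectionTerm hv.memLp hw 0
  have h0 : advectionTerm v w 0 = fun _ => 0 := by
    funext l
    have h1 := hv.div_free (-l)
    rw [latticeDot_neg, neg_eq_zero] at h1
    rw [advectionTerm, zero_sub, h1]
    simp
  rw [h0] at h
  exact h.unique hasSum_zero

/-- The bilinear map is defined by its Fourier coefficients, and maps into `H^p`. -/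
lemma nsBilinear_spec (hn : (d : ℝ) / 2 + 1 < n) (hp : n ≤ p)
    (hv : MemSobolev p v) (hw : MemSobolev (p + 1) w) :
    MemSobolev p (nsBilinear v w) ∧
      ∀ k, coeff (nsBilinear v w) k = leraySymbol k (coeff (advection v w) k) := by
  have hp1 : 1 ≤ p := by
    have : (0 : ℝ) ≤ d := Nat.cast_nonneg d
    linarith
  have hsum := summable_rpow_norm_coeff_advection hn hp hv hw
  have hzero := coeff_advection_zero (hv.mono (by linarith)) (hw.mono (by linarith))
  have hex : ∃ g : Field d, MemLp g 2 volume ∧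
      ∀ k, coeff g k = leraySymbol k (coeff (advection v w) k) := by
    refine exists_field_coeff_eq ?_ fun k s => leraySymbol_neg (coeff_neg _ k) s
    refine hsum.of_nonneg_of_le (fun k => sq_nonneg _) fun k => ?_
    refine pow_le_pow_left₀ (norm_nonneg _) ((norm_leraySymbol_le _ _).trans ?_) 2
    by_cases hk : k = 0
    · simp [hk, hzero]
    · exact le_mul_of_one_le_left (norm_nonneg _)
        (Real.one_le_rpow (one_le_latticeNorm hk) (by linarith))
  have hdef : nsBilinear v w = hex.choose := by
    rw [nsBilinear, leray, dif_pos hex]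
  obtain ⟨hmem, hco⟩ := hex.choose_spec
  rw [← hdef] at hmem hco
  refine ⟨⟨hmem, fun k => by rw [hco, latticeDot_leraySymbol],
    by rw [hco, hzero, leraySymbol_zero], ?_⟩, hco⟩
  refine (hsum.comp_injective (Subtype.val_injective (p := (· ≠ 0)))).of_nonneg_of_le
    (fun k => by rw [← sobolevCoeff_sq]; positivity) fun k => ?_
  rw [← sobolevCoeff_sq, sobolevCoeff, hco]
  refine pow_le_pow_left₀ (mul_nonneg (Real.rpow_nonneg (latticeNorm_nonneg _) p)
    (norm_nonneg _)) ?_ 2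
  exact mul_le_mul_of_nonneg_left (norm_leraySymbol_le _ _)
    (Real.rpow_nonneg (latticeNorm_nonneg _) p)

/-! ### The inner product as a double series -/

/-- The contribution of the modes `k - l` of `v` and `l`, `k` of `w` to `⟨v · ∂w | w⟩`. -/
noncomputable def triadTerm (v w : Field d) (x : (Fin d → ℤ) × (Fin d → ℤ)) : ℂ :=
  inner ℂ (advectionTerm v w x.1 x.2) (coeff w x.1)

lemma norm_triadTerm_le (v w : Field d) (x : (Fin d → ℤ) × (Fin d → ℤ)) :
    ‖triadTerm v w x‖ ≤ modeConst d * (‖coeff v (x.1 - x.2)‖ *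
      (latticeNorm x.2 * ‖coeff w x.2‖) * ‖coeff w x.1‖) := by
  have h1 := norm_advectionTerm_le v w x.1 x.2
  simp only [sobolevCoeff, Real.rpow_zero, one_mul, Real.rpow_one] at h1
  calc _ ≤ ‖advectionTerm v w x.1 x.2‖ * ‖coeff w x.1‖ := norm_inner_le_norm _ _
    _ ≤ _ := mul_le_mul_of_nonneg_right h1 (norm_nonneg _)
    _ = _ := by ring

lemma inner_coeff_neg (w : Field d) (k l : Fin d → ℤ) :
    inner ℂ (coeff w (-k)) (coeff w (-l)) = inner ℂ (coeff w l) (coeff w k) := by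
  rw [← sum_conj_mul_eq_inner, ← sum_conj_mul_eq_inner]
  simp [coeff_neg, mul_comm]

/-- The antisymmetry which expresses that `v · ∂` is skew-adjoint for divergence free `v`. -/
lemma triadTerm_neg_swap (hv : ∀ k, latticeDot k (coeff v k) = 0)
    (x : (Fin d → ℤ) × (Fin d → ℤ)) : triadTerm v w (-x.2, -x.1) = -triadTerm v w x := by
  have h1 : latticeDot x.1 (coeff v (x.1 - x.2)) = latticeDot x.2 (coeff v (x.1 - x.2)) := by
    have := hv (x.1 - x.2)
    rw [latticeDot_sub] at this
    exact sub_eq_zero.mp this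
  simp only [triadTerm, advectionTerm, inner_smul_left, inner_coeff_neg, latticeDot_neg,
    show -x.2 - -x.1 = x.1 - x.2 by abel, h1]
  simp

lemma summable_rpow_mul_triadTerm (hn : (d : ℝ) / 2 + 1 < n) (hp : n ≤ p)
    (hv : MemSobolev p v) (hw : MemSobolev (p + 1) w) :
    Summable fun x : (Fin d → ℤ) × (Fin d → ℤ) =>
      ((latticeNorm x.1 ^ (2 * p) : ℝ) : ℂ) * triadTerm v w x := by
  have hp1 : 1 ≤ p := by
    have : (0 : ℝ) ≤ d := Nat.cast_nonneg d
    linarith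
  have hwp : MemSobolev p w := hw.mono (by linarith)
  have h1 := (young_trilinear' (sobolevCoeff_nonneg p v) (sobolevCoeff_nonneg 1 w)
    (sobolevCoeff_nonneg p w) hv.summable_sobolevCoeff_sq
    ((hwp.mono hp).summable_sobolevCoeff_one hn).1 hwp.summable_sobolevCoeff_sq).1
  have h2 := (young_trilinear (sobolevCoeff_nonneg 0 v) (sobolevCoeff_nonneg (p + 1) w)
    (sobolevCoeff_nonneg p w) (summable_sobolevCoeff_zero hn (hv.mono hp))
    hw.summable_sobolevCoeff_sq hwp.summable_sobolevCoeff_sq).1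
  refine Summable.of_norm_bounded ((h1.add h2).mul_left (modeConst d * 2 ^ (p - 1))) fun x => ?_
  have h3 : ‖triadTerm v w x‖ ≤ ‖advectionTerm v w x.1 x.2‖ * ‖coeff w x.1‖ :=
    norm_inner_le_norm _ _
  have h4 := rpow_mul_norm_advectionTerm_le hp1 v w x.1 x.2
  have h5 := Real.rpow_nonneg (latticeNorm_nonneg x.1) p
  have h6 : latticeNorm x.1 ^ (2 * p) = latticeNorm x.1 ^ p * latticeNorm x.1 ^ p := by
    rw [mul_comm, Real.rpow_mul (latticeNorm_nonneg _), Real.rpow_two, sq]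
  rw [norm_mul, Complex.norm_real, h6, Real.norm_of_nonneg (by positivity)]
  calc _ ≤ latticeNorm x.1 ^ p * latticeNorm x.1 ^ p *
        (‖advectionTerm v w x.1 x.2‖ * ‖coeff w x.1‖) := by gcongr
    _ = (latticeNorm x.1 ^ p * ‖advectionTerm v w x.1 x.2‖) * sobolevCoeff p w x.1 := by
        rw [sobolevCoeff]; ring
    _ ≤ _ := mul_le_mul_of_nonneg_right h4 (sobolevCoeff_nonneg _ _ _)
    _ = _ := by ring

lemma sobolevInner_nsBilinear_eq_tsum (hn : (d : ℝ) / 2 + 1 < n) (hp : n ≤ p)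
    (hv : MemSobolev p v) (hw : MemSobolev (p + 1) w) :
    sobolevInner p (nsBilinear v w) w = ∑' x : (Fin d → ℤ) × (Fin d → ℤ),
      ((latticeNorm x.1 ^ (2 * p) : ℝ) : ℂ) * triadTerm v w x := by
  have hp1 : 1 ≤ p := by
    have : (0 : ℝ) ≤ d := Nat.cast_nonneg d
    linarith
  rw [sobolevInner_eq p hw.mean_zero, (summable_rpow_mul_triadTerm hn hp hv hw).tsum_prod]
  refine tsum_congr fun k => ?_
  simp only [tsum_mul_left]
  rw [(nsBilinear_spec hn hp hv hw).2, inner_leraySymbol (hw.div_free k)]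
  congr 1
  have h1 := (hasSum_advectionTerm hv.memLp (hw.mono (by linarith) : MemSobolev 1 w) k)
  have h2 := (innerSL ℂ (coeff w k)).hasSum h1
  have h3 := Complex.hasSum_conj'.mpr h2
  simp only [innerSL_apply_apply, inner_conj_symm] at h3
  exact h3.tsum_eq.symm

/-- By antisymmetry, one factor `|k|^p` of the weight is replaced by `|k|^p - |l|^p`. -/
lemma sobolevInner_nsBilinear_eq_commutator (hn : (d : ℝ) / 2 + 1 < n) (hp : n ≤ p)
    (hv : MemSobolev p v) (hw : MemSobolev (p + 1) w) :
    sobolevInner p (nsBilinear v w) w = ∑' x : (Fin d → ℤ) × (Fin d → ℤ),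
      ((latticeNorm x.1 ^ p * (latticeNorm x.1 ^ p - latticeNorm x.2 ^ p) : ℝ) : ℂ) *
        triadTerm v w x := by
  have hp1 : 1 ≤ p := by
    have : (0 : ℝ) ≤ d := Nat.cast_nonneg d
    linarith
  have hwp : MemSobolev p w := hw.mono (by linarith)
  set U : (Fin d → ℤ) × (Fin d → ℤ) → ℂ := fun x =>
    ((latticeNorm x.1 ^ p * latticeNorm x.2 ^ p : ℝ) : ℂ) * triadTerm v w x with hU
  have hUs : Summable U := by
    have h2 := (young_trilinear (sobolevCoeff_nonneg 0 v) (sobolevCoeff_nonneg (p + 1) w)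
      (sobolevCoeff_nonneg p w) (summable_sobolevCoeff_zero hn (hv.mono hp))
      hw.summable_sobolevCoeff_sq hwp.summable_sobolevCoeff_sq).1
    refine Summable.of_norm_bounded (h2.mul_left (modeConst d)) fun x => ?_
    have h5 := Real.rpow_nonneg (latticeNorm_nonneg x.1) p
    have h6 := Real.rpow_nonneg (latticeNorm_nonneg x.2) p
    have h3 := rpow_mul_self (latticeNorm_nonneg x.2) (by linarith : p + 1 ≠ 0)
    rw [hU, norm_mul, Complex.norm_real, Real.norm_of_nonneg (by positivity)]
    calc _ ≤ latticeNorm x.1 ^ p * latticeNorm x.2 ^ p * (modeConst d *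
          (‖coeff v (x.1 - x.2)‖ * (latticeNorm x.2 * ‖coeff w x.2‖) * ‖coeff w x.1‖)) := by
          gcongr
          exact norm_triadTerm_le v w x
      _ = _ := by
          simp only [sobolevCoeff, Real.rpow_zero, ← h3]
          ring
  have hU0 : ∑' x, U x = 0 := by
    let σ : (Fin d → ℤ) × (Fin d → ℤ) ≃ (Fin d → ℤ) × (Fin d → ℤ) :=
      { toFun := fun x => (-x.2, -x.1)
        invFun := fun x => (-x.2, -x.1)
        left_inv := fun x => by simp
        right_inv := fun x => by simp }
    have h1 : ∀ x, U (σ x) = -U x := fun x => by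
      change ((latticeNorm (-x.2) ^ p * latticeNorm (-x.1) ^ p : ℝ) : ℂ) *
        triadTerm v w (-x.2, -x.1) = _
      rw [triadTerm_neg_swap hv.div_free, latticeNorm_neg, latticeNorm_neg, hU]
      push_cast
      ring
    have h2 := σ.tsum_eq U
    simp only [h1, tsum_neg] at h2
    exact self_eq_neg.mp h2.symm
  rw [sobolevInner_nsBilinear_eq_tsum hn hp hv hw, ← sub_zero (tsum _), ← hU0,
    ← (summable_rpow_mul_triadTerm hn hp hv hw).tsum_sub hUs]
  refine tsum_congr fun x => ?_
  have h6 : latticeNorm x.1 ^ (2 * p) = latticeNorm x.1 ^ p * latticeNorm x.1 ^ p := by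
    rw [mul_comm, Real.rpow_mul (latticeNorm_nonneg _), Real.rpow_two, sq]
  rw [hU, h6]
  push_cast
  ring

/-! ### The tame Kato inequality -/

/-- The mean value inequality for powers. -/
lemma abs_rpow_sub_rpow_le {x y M p : ℝ} (hx : 0 ≤ x) (hy : 0 ≤ y) (hxM : x ≤ M) (hyM : y ≤ M)
    (hp : 1 ≤ p) : |x ^ p - y ^ p| ≤ p * M ^ (p - 1) * |x - y| := by
  have h := Convex.norm_image_sub_le_of_norm_hasDerivWithin_le (s := Set.Icc 0 M)
    (f := fun t : ℝ => t ^ p) (f' := fun t => p * t ^ (p - 1)) (C := p * M ^ (p - 1))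
    (fun t _ => (Real.hasDerivAt_rpow_const (Or.inr hp)).hasDerivWithinAt)
    (fun t ht => by
      rw [Real.norm_of_nonneg (mul_nonneg (by linarith) (Real.rpow_nonneg ht.1 _))]
      exact mul_le_mul_of_nonneg_left (Real.rpow_le_rpow ht.1 ht.2 (by linarith)) (by linarith))
    (convex_Icc 0 M) ⟨hy, hyM⟩ ⟨hx, hxM⟩
  simpa [Real.norm_eq_abs] using h

lemma abs_rpow_sub_rpow_mul_le {x y b p : ℝ} (hx : 0 ≤ x) (hy : 0 ≤ y) (hb : |x - y| ≤ b)
    (hp : 2 ≤ p) :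
    |x ^ p - y ^ p| * y ≤ p * 2 ^ (p - 2) * (b * y ^ p + b ^ p * y) := by
  have hb0 : 0 ≤ b := (abs_nonneg _).trans hb
  have h1 := abs_rpow_sub_rpow_le (M := y + b) hx hy (by linarith [(abs_le.mp hb).2])
    (by linarith) (by linarith : 1 ≤ p)
  have h2 := add_rpow_le_mul_rpow_add_rpow hy hb0 (by linarith : 1 ≤ p - 1)
  rw [show p - 1 - 1 = p - 2 by ring] at h2
  have hy1 := rpow_mul_self hy (p := p - 1) (by linarith)
  have hb1 := rpow_mul_self hb0 (p := p - 1) (by linarith)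
  rw [sub_add_cancel] at hy1 hb1
  have h3 := Real.rpow_nonneg (add_nonneg hy hb0) (p - 1)
  calc _ ≤ (p * (y + b) ^ (p - 1) * |x - y|) * y := by gcongr
    _ ≤ (p * (2 ^ (p - 2) * (y ^ (p - 1) + b ^ (p - 1))) * b) * y := by gcongr
    _ = _ := by rw [← hy1, ← hb1]; ring

lemma norm_commutator_mul_triadTerm_le (hp : 2 ≤ p) (v w : Field d)
    (x : (Fin d → ℤ) × (Fin d → ℤ)) :
    ‖((latticeNorm x.1 ^ p * (latticeNorm x.1 ^ p - latticeNorm x.2 ^ p) : ℝ) : ℂ) *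
        triadTerm v w x‖ ≤ modeConst d * (p * 2 ^ (p - 2)) *
      (sobolevCoeff 1 v (x.1 - x.2) * sobolevCoeff p w x.2 * sobolevCoeff p w x.1 +
        sobolevCoeff p v (x.1 - x.2) * sobolevCoeff 1 w x.2 * sobolevCoeff p w x.1) := by
  have h1 := abs_rpow_sub_rpow_mul_le (latticeNorm_nonneg x.1) (latticeNorm_nonneg x.2)
    (abs_latticeNorm_sub_le x.1 x.2) hp
  have h5 := Real.rpow_nonneg (latticeNorm_nonneg x.1) p
  have hκ := (modeConst_pos d).le
  rw [norm_mul, Complex.norm_real, norm_mul, Real.norm_of_nonneg h5, Real.norm_eq_abs]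
  calc _ ≤ latticeNorm x.1 ^ p * |latticeNorm x.1 ^ p - latticeNorm x.2 ^ p| * (modeConst d *
        (‖coeff v (x.1 - x.2)‖ * (latticeNorm x.2 * ‖coeff w x.2‖) * ‖coeff w x.1‖)) := by
        gcongr
        exact norm_triadTerm_le v w x
    _ = (|latticeNorm x.1 ^ p - latticeNorm x.2 ^ p| * latticeNorm x.2) * (modeConst d *
        (latticeNorm x.1 ^ p * (‖coeff v (x.1 - x.2)‖ * ‖coeff w x.2‖ * ‖coeff w x.1‖))) := by
        ring
    _ ≤ _ := mul_le_mul_of_nonneg_right h1 (by positivity)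
    _ = _ := by
        simp only [sobolevCoeff, Real.rpow_one]
        ring

/-- The tame Kato inequality, with a constant whose `p`-th root tends to `2`. -/
lemma mem_tameKatoConstants (hd : 2 ≤ d) (hn : (d : ℝ) / 2 + 1 < n) (hp : n ≤ p) :
    modeConst d * embeddingConst d n * p * 2 ^ (p - 1) ∈ tameKatoConstants d p n := by
  intro v w hv hw
  have hp2 : 2 ≤ p := by
    have : (2 : ℝ) ≤ d := by exact_mod_cast hd
    linarith
  have hwp : MemSobolev p w := hw.mono (by linarith)
  have hv1 := (hv.mono hp).summable_sobolevCoeff_one hn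
  have hw1 := (hwp.mono hp).summable_sobolevCoeff_one hn
  have hs1 := young_trilinear (sobolevCoeff_nonneg 1 v) (sobolevCoeff_nonneg p w)
    (sobolevCoeff_nonneg p w) hv1.1 hwp.summable_sobolevCoeff_sq hwp.summable_sobolevCoeff_sq
  have hs2 := young_trilinear' (sobolevCoeff_nonneg p v) (sobolevCoeff_nonneg 1 w)
    (sobolevCoeff_nonneg p w) hv.summable_sobolevCoeff_sq hw1.1 hwp.summable_sobolevCoeff_sq
  rw [← sobolevNorm_eq p hw.mean_zero] at hs1 hs2
  rw [← sobolevNorm_eq p hv.mean_zero] at hs2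
  have hb := tsum_of_norm_bounded
    ((hs1.1.add hs2.1).mul_left (modeConst d * (p * 2 ^ (p - 2)))).hasSum
    (norm_commutator_mul_triadTerm_le hp2 v w)
  rw [← sobolevInner_nsBilinear_eq_commutator hn hp hv hw, tsum_mul_left,
    hs1.1.tsum_add hs2.1] at hb
  have hκ := (modeConst_pos d).le
  have hvp := sobolevNorm_nonneg p v
  have hwp' := sobolevNorm_nonneg p w
  calc _ ≤ _ := hb
    _ ≤ modeConst d * (p * 2 ^ (p - 2)) *
        (embeddingConst d n * sobolevNorm n v * (sobolevNorm p w * sobolevNorm p w) +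
          embeddingConst d n * sobolevNorm n w * (sobolevNorm p v * sobolevNorm p w)) := by
        gcongr
        · exact hs1.2.trans (mul_le_mul_of_nonneg_right hv1.2 (by positivity))
        · exact hs2.2.trans (mul_le_mul_of_nonneg_right hw1.2 (by positivity))
    _ = _ := by
        rw [show p - 1 = p - 2 + 1 by ring, Real.rpow_add_one (by norm_num)]
        ring

end

end

section

/-! ### Trigonometric polynomials -/

section

variable {d : ℕ}

/-- Divergence free trigonometric polynomials belong to all the Sobolev spaces. -/
lemma exists_memSobolev_of_finset {c : (Fin d → ℤ) → EuclideanSpace ℂ (Fin d)}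
    {S : Finset (Fin d → ℤ)} (hS : ∀ k, k ∉ S → c k = 0)
    (hreal : ∀ k s, c (-k) s = conj (c k s)) (hdiv : ∀ k, latticeDot k (c k) = 0)
    (h0 : c 0 = 0) : ∃ v : Field d, (∀ m, MemSobolev m v) ∧ ∀ k, coeff v k = c k := by
  obtain ⟨v, hv, hvc⟩ := exists_field_coeff_eq
    (summable_of_ne_finset_zero (s := S) fun k hk => by simp [hS k hk]) hreal
  refine ⟨v, fun m => ⟨hv, fun k => by rw [hvc, hdiv], by rw [hvc, h0], ?_⟩, hvc⟩
  refine (summable_of_ne_finset_zero (s := S) (f := fun k : Fin d → ℤ =>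
    latticeNorm k ^ (2 * m) * ‖coeff v k‖ ^ 2) fun k hk => ?_).comp_injective
      Subtype.val_injective
  simp [hvc, hS k hk]

lemma sobolevNorm_le_of_finset {m B : ℝ} {M : ℕ} {v : Field d} (h0 : coeff v 0 = 0)
    {S : Finset (Fin d → ℤ)} (hS : ∀ k, k ∉ S → coeff v k = 0) (hM : S.card ≤ M) (hB : 0 ≤ B)
    (h : ∀ k ∈ S, sobolevCoeff m v k ≤ B) : sobolevNorm m v ≤ M * B := by
  rw [sobolevNorm_eq m h0, tsum_eq_sum (s := S) fun k hk => by
    simp [sobolevCoeff_eq_zero (hS k hk)]]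
  refine Real.sqrt_le_iff.mpr ⟨by positivity, ?_⟩
  calc _ ≤ S.card • B ^ 2 := Finset.sum_le_card_nsmul _ _ _ fun k hk =>
        pow_le_pow_left₀ (sobolevCoeff_nonneg _ _ _) (h k hk) 2
    _ = (S.card : ℝ) * B ^ 2 := nsmul_eq_mul _ _
    _ ≤ (M ^ 2 : ℕ) * B ^ 2 := by
        gcongr
        nlinarith
    _ = _ := by push_cast; ring

end

/-- The vector `(a, b, 0, …, 0)`. -/
def planeVec {α : Type*} [Zero α] (m : ℕ) (a b : α) : Fin (m + 2) → α :=
  Fin.cons a (Fin.cons b 0)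

section

variable {m : ℕ}

lemma planeVec_inj {α : Type*} [Zero α] {a b a' b' : α} :
    planeVec m a b = planeVec m a' b' ↔ a = a' ∧ b = b' := by
  simp [planeVec, Fin.cons_inj]

lemma neg_planeVec (a b : ℤ) : -planeVec m a b = planeVec m (-a) (-b) := by
  ext s
  refine Fin.cases ?_ (fun s => Fin.cases ?_ (fun s => ?_) s) s <;> simp [planeVec]

lemma planeVec_sub (a b a' b' : ℤ) :
    planeVec m a b - planeVec m a' b' = planeVec m (a - a') (b - b') := by
  ext s
  refine Fin.cases ?_ (fun s => Fin.cases ?_ (fun s => ?_) s) s <;> simp [planeVec]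

lemma planeVec_zero : (0 : Fin (m + 2) → ℤ) = planeVec m 0 0 := by
  ext s
  refine Fin.cases ?_ (fun s => Fin.cases ?_ (fun s => ?_) s) s <;> simp [planeVec]

lemma latticeNorm_planeVec (a b : ℤ) :
    latticeNorm (planeVec m a b) = Real.sqrt ((a : ℝ) ^ 2 + (b : ℝ) ^ 2) := by
  simp [latticeNorm, Fin.sum_univ_succ, planeVec]

/-- The vector `(a, b, 0, …, 0)` of `ℂ^d`, for real `a`, `b`. -/
noncomputable def complexPlaneVec (m : ℕ) (a b : ℝ) : EuclideanSpace ℂ (Fin (m + 2)) :=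
  WithLp.toLp 2 (fun s => ((planeVec m a b s : ℝ) : ℂ))

lemma conj_complexPlaneVec (a b : ℝ) (s : Fin (m + 2)) :
    conj (complexPlaneVec m a b s) = complexPlaneVec m a b s := by
  simp [complexPlaneVec]

lemma latticeDot_planeVec (a b : ℤ) (x y : ℝ) :
    latticeDot (planeVec m a b) (complexPlaneVec m x y) = a * x + b * y := by
  simp [latticeDot, Fin.sum_univ_succ, planeVec, complexPlaneVec]

lemma inner_complexPlaneVec (a b x y : ℝ) :
    inner ℂ (complexPlaneVec m a b) (complexPlaneVec m x y) = a * x + b * y := by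
  rw [← sum_conj_mul_eq_inner]
  simp [Fin.sum_univ_succ, planeVec, complexPlaneVec]

lemma norm_complexPlaneVec (a b : ℝ) : ‖complexPlaneVec m a b‖ = Real.sqrt (a ^ 2 + b ^ 2) := by
  simp [EuclideanSpace.norm_eq, Fin.sum_univ_succ, planeVec, complexPlaneVec]

lemma latticeDot_smul {d : ℕ} (k : Fin d → ℤ) (a : ℂ) (c : EuclideanSpace ℂ (Fin d)) :
    latticeDot k (a • c) = a * latticeDot k c := by
  rw [latticeDot_eq_inner, latticeDot_eq_inner, inner_smul_right]

lemma latticeDot_add {d : ℕ} (k : Fin d → ℤ) (c c' : EuclideanSpace ℂ (Fin d)) :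
    latticeDot k (c + c') = latticeDot k c + latticeDot k c' := by
  rw [latticeDot_eq_inner, latticeDot_eq_inner, latticeDot_eq_inner, inner_add_right]

/-- The indicator of `{H, -H}` with signs `1` and `-1`. -/
noncomputable def oddIndicator {d : ℕ} (H k : Fin d → ℤ) : ℂ :=
  (if k = H then 1 else 0) - (if k = -H then 1 else 0)

/-- The indicator of `{H, -H}`. -/
noncomputable def evenIndicator {d : ℕ} (H k : Fin d → ℤ) : ℂ :=
  (if k = H then 1 else 0) + (if k = -H then 1 else 0)

lemma oddIndicator_neg {d : ℕ} (H k : Fin d → ℤ) : oddIndicator H (-k) = -oddIndicator H k := by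
  simp only [oddIndicator, neg_eq_iff_eq_neg (a := k), neg_neg]
  ring

lemma evenIndicator_neg {d : ℕ} (H k : Fin d → ℤ) : evenIndicator H (-k) = evenIndicator H k := by
  simp only [evenIndicator, neg_eq_iff_eq_neg (a := k), neg_neg]
  ring

lemma conj_oddIndicator {d : ℕ} (H k : Fin d → ℤ) :
    conj (oddIndicator H k) = oddIndicator H k := by
  simp only [oddIndicator, map_sub, apply_ite conj, map_one, map_zero]

lemma conj_evenIndicator {d : ℕ} (H k : Fin d → ℤ) :
    conj (evenIndicator H k) = evenIndicator H k := by
  simp only [evenIndicator, map_add, apply_ite conj, map_one, map_zero]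

lemma oddIndicator_eq_zero {d : ℕ} {H k : Fin d → ℤ} (h : k ≠ H) (h' : k ≠ -H) :
    oddIndicator H k = 0 := by simp [oddIndicator, h, h']

lemma evenIndicator_eq_zero {d : ℕ} {H k : Fin d → ℤ} (h : k ≠ H) (h' : k ≠ -H) :
    evenIndicator H k = 0 := by simp [evenIndicator, h, h']

/-- A function vanishing off `{H, -H}` times a linear form vanishing at `H`. -/
lemma mul_latticeDot_eq_zero {d : ℕ} {H k : Fin d → ℤ} {a : ℂ}
    (ha : k ≠ H → k ≠ -H → a = 0) {c : EuclideanSpace ℂ (Fin d)} (hc : latticeDot H c = 0) :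
    a * latticeDot k c = 0 := by
  by_cases h : k = H
  · rw [h, hc, mul_zero]
  by_cases h' : k = -H
  · rw [h', latticeDot_neg, hc, neg_zero, mul_zero]
  rw [ha h h', zero_mul]

/-! ### Test fields -/

/-- The advecting test field `v` has the frequencies `±(N, 1)`. -/
lemma exists_advecting_field (m : ℕ) {N : ℤ} (hN : 1 ≤ N) :
    ∃ v : Field (m + 2), (∀ q, MemSobolev q v) ∧ ∀ k, coeff v k =
      (oddIndicator (planeVec m N 1) k * Complex.I) • complexPlaneVec m 1 (-N) := by
  refine exists_memSobolev_of_finset (S := {planeVec m N 1, -planeVec m N 1}) ?_ ?_ ?_ ?_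
  · intro k hk
    simp only [Finset.mem_insert, Finset.mem_singleton, not_or] at hk
    rw [oddIndicator_eq_zero hk.1 hk.2, zero_mul, zero_smul]
  · intro k s
    simp [oddIndicator_neg, conj_oddIndicator, conj_complexPlaneVec]
  · intro k
    rw [latticeDot_smul, mul_right_comm, mul_latticeDot_eq_zero (H := planeVec m N 1)
      oddIndicator_eq_zero (by rw [latticeDot_planeVec]; simp), zero_mul]
  · rw [oddIndicator_eq_zero, zero_mul, zero_smul]
    · rw [planeVec_zero, Ne, planeVec_inj]; omega
    · rw [planeVec_zero, neg_planeVec, Ne, planeVec_inj]; omega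

/-- The advected test field `w` has the frequencies `±(N, 0)` and `±(2N, 1)`, the latter with
amplitude `t`. -/
lemma exists_advected_field (m : ℕ) {N : ℤ} (hN : 1 ≤ N) (t : ℝ) :
    ∃ w : Field (m + 2), (∀ q, MemSobolev q w) ∧ ∀ k, coeff w k =
      evenIndicator (planeVec m N 0) k • complexPlaneVec m 0 1 +
        (evenIndicator (planeVec m (2 * N) 1) k * t) • complexPlaneVec m 1 (-(2 * N)) := by
  refine exists_memSobolev_of_finset (S := {planeVec m N 0, -planeVec m N 0,
    planeVec m (2 * N) 1, -planeVec m (2 * N) 1}) ?_ ?_ ?_ ?_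
  · intro k hk
    simp only [Finset.mem_insert, Finset.mem_singleton, not_or] at hk
    rw [evenIndicator_eq_zero hk.1 hk.2.1, evenIndicator_eq_zero hk.2.2.1 hk.2.2.2, zero_mul,
      zero_smul, zero_smul, add_zero]
  · intro k s
    simp [evenIndicator_neg, conj_evenIndicator, conj_complexPlaneVec]
  · intro k
    rw [latticeDot_add, latticeDot_smul, latticeDot_smul, mul_right_comm,
      mul_latticeDot_eq_zero (H := planeVec m N 0) evenIndicator_eq_zero
        (by rw [latticeDot_planeVec]; simp),
      mul_latticeDot_eq_zero (H := planeVec m (2 * N) 1) evenIndicator_eq_zero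
        (by rw [latticeDot_planeVec]; simp), zero_mul, zero_add]
  · rw [evenIndicator_eq_zero, evenIndicator_eq_zero, zero_mul, zero_smul, zero_smul, add_zero]
    · rw [planeVec_zero, Ne, planeVec_inj]; omega
    · rw [planeVec_zero, neg_planeVec, Ne, planeVec_inj]; omega
    · rw [planeVec_zero, Ne, planeVec_inj]; omega
    · rw [planeVec_zero, neg_planeVec, Ne, planeVec_inj]; omega

section

variable {N : ℤ} {t : ℝ} {v w : Field (m + 2)}

lemma coeff_advected_planeVec (hN : 1 ≤ N) (hw : ∀ k, coeff w k =
      evenIndicator (planeVec m N 0) k • complexPlaneVec m 0 1 +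
        (evenIndicator (planeVec m (2 * N) 1) k * t) • complexPlaneVec m 1 (-(2 * N))) :
    coeff w (planeVec m N 0) = complexPlaneVec m 0 1 ∧
      coeff w (planeVec m (2 * N) 1) = (t : ℂ) • complexPlaneVec m 1 (-(2 * N)) := by
  constructor
  · have h1 : N ≠ -N := by omega
    have h2 : N ≠ 2 * N := by omega
    simp [hw, evenIndicator, neg_planeVec, planeVec_inj, h1, h2]
  · have h1 : 2 * N ≠ -(2 * N) := by omega
    have h2 : 2 * N ≠ N := by omega
    simp [hw, evenIndicator, neg_planeVec, planeVec_inj, h1, h2]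

lemma coeff_advected_neg_planeVec (hN : 1 ≤ N) (hw : ∀ k, coeff w k =
      evenIndicator (planeVec m N 0) k • complexPlaneVec m 0 1 +
        (evenIndicator (planeVec m (2 * N) 1) k * t) • complexPlaneVec m 1 (-(2 * N))) :
    coeff w (-planeVec m N 0) = complexPlaneVec m 0 1 ∧
      coeff w (-planeVec m (2 * N) 1) = (t : ℂ) • complexPlaneVec m 1 (-(2 * N)) := by
  obtain ⟨h1, h2⟩ := coeff_advected_planeVec hN hw
  rw [hw] at h1 h2
  rw [hw, hw]
  simp only [evenIndicator_neg]
  exact ⟨h1, h2⟩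

lemma coeff_advecting_planeVec (hN : 1 ≤ N) (hv : ∀ k, coeff v k =
      (oddIndicator (planeVec m N 1) k * Complex.I) • complexPlaneVec m 1 (-N)) :
    coeff v (planeVec m N 1) = Complex.I • complexPlaneVec m 1 (-N) ∧
      coeff v (-planeVec m N 1) = -Complex.I • complexPlaneVec m 1 (-N) := by
  have h1 : N ≠ -N := by omega
  have h2 : -N ≠ N := by omega
  simp [hv, oddIndicator, neg_planeVec, planeVec_inj, h1, h2]

lemma triadTerm_eq_zero (hN : 1 ≤ N) (hv : ∀ k, coeff v k =
      (oddIndicator (planeVec m N 1) k * Complex.I) • complexPlaneVec m 1 (-N))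
    (hw : ∀ k, coeff w k =
      evenIndicator (planeVec m N 0) k • complexPlaneVec m 0 1 +
        (evenIndicator (planeVec m (2 * N) 1) k * t) • complexPlaneVec m 1 (-(2 * N)))
    {x : (Fin (m + 2) → ℤ) × (Fin (m + 2) → ℤ)}
    (hx : x ∉ ({(planeVec m (2 * N) 1, planeVec m N 0), (-planeVec m (2 * N) 1, -planeVec m N 0),
      (planeVec m N 0, planeVec m (2 * N) 1), (-planeVec m N 0, -planeVec m (2 * N) 1)} :
      Finset ((Fin (m + 2) → ℤ) × (Fin (m + 2) → ℤ)))) : triadTerm v w x = 0 := by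
  have hw0 : ∀ k, ¬(k = planeVec m N 0 ∨ k = -planeVec m N 0 ∨ k = planeVec m (2 * N) 1 ∨
      k = -planeVec m (2 * N) 1) → coeff w k = 0 := by
    intro k hk
    simp only [not_or] at hk
    rw [hw, evenIndicator_eq_zero hk.1 hk.2.1, evenIndicator_eq_zero hk.2.2.1 hk.2.2.2, zero_mul,
      zero_smul, zero_smul, add_zero]
  obtain ⟨k, l⟩ := x
  by_cases hk : k = planeVec m N 0 ∨ k = -planeVec m N 0 ∨ k = planeVec m (2 * N) 1 ∨
      k = -planeVec m (2 * N) 1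
  swap
  · simp [triadTerm, hw0 k hk]
  by_cases hl : l = planeVec m N 0 ∨ l = -planeVec m N 0 ∨ l = planeVec m (2 * N) 1 ∨
      l = -planeVec m (2 * N) 1
  swap
  · simp [triadTerm, advectionTerm, hw0 l hl]
  have hkl : oddIndicator (planeVec m N 1) (k - l) = 0 := by
    simp only [neg_planeVec] at hx hk hl
    rcases hk with rfl | rfl | rfl | rfl <;> rcases hl with rfl | rfl | rfl | rfl <;>
      first
        | (simp at hx; done)
        | (apply oddIndicator_eq_zero <;>
            simp only [neg_planeVec, planeVec_sub, ne_eq, planeVec_inj] <;> omega)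
  simp [triadTerm, advectionTerm, hv, hkl, latticeDot]

/-- The inner product `⟨𝒫(v, w) | w⟩_p` of the test fields: only the triads formed by `±(N, 1)`,
`±(N, 0)` and `±(2N, 1)` contribute. -/
lemma sobolevInner_test_eq {n p : ℝ} (hn : ((m + 2 : ℕ) : ℝ) / 2 + 1 < n) (hp : n ≤ p)
    (hN : 1 ≤ N) (hvp : MemSobolev p v) (hwp : MemSobolev (p + 1) w)
    (hv : ∀ k, coeff v k =
      (oddIndicator (planeVec m N 1) k * Complex.I) • complexPlaneVec m 1 (-N))
    (hw : ∀ k, coeff w k =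
      evenIndicator (planeVec m N 0) k • complexPlaneVec m 0 1 +
        (evenIndicator (planeVec m (2 * N) 1) k * t) • complexPlaneVec m 1 (-(2 * N))) :
    sobolevInner p (nsBilinear v w) w =
      (((latticeNorm (planeVec m (2 * N) 1) ^ (2 * p) - latticeNorm (planeVec m N 0) ^ (2 * p)) *
        (4 * modeConst (m + 2) * N ^ 2 * t) : ℝ) : ℂ) := by
  obtain ⟨hL, hK⟩ := coeff_advected_planeVec hN hw
  obtain ⟨hL', hK'⟩ := coeff_advected_neg_planeVec hN hw
  obtain ⟨hH, hH'⟩ := coeff_advecting_planeVec hN hv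
  have hKL : planeVec m (2 * N) 1 - planeVec m N 0 = planeVec m N 1 := by
    rw [planeVec_sub, planeVec_inj]; omega
  have hKL' : -planeVec m (2 * N) 1 - -planeVec m N 0 = -planeVec m N 1 := by
    rw [← hKL]; abel
  have h1 : triadTerm v w (planeVec m (2 * N) 1, planeVec m N 0) =
      ((2 * modeConst (m + 2) * N ^ 2 * t : ℝ) : ℂ) := by
    simp only [triadTerm, advectionTerm, hKL, hH, hL, hK, latticeDot_smul, latticeDot_planeVec,
      inner_smul_left, inner_smul_right, inner_complexPlaneVec, map_mul, map_add,
      Complex.conj_I, Complex.conj_ofReal, map_intCast]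
    push_cast
    linear_combination (-(2 : ℂ) * modeConst (m + 2) * N ^ 2 * t) * Complex.I_sq
  have h2 : triadTerm v w (-planeVec m (2 * N) 1, -planeVec m N 0) =
      ((2 * modeConst (m + 2) * N ^ 2 * t : ℝ) : ℂ) := by
    simp only [triadTerm, advectionTerm, hKL', hH', hL', hK', latticeDot_smul, latticeDot_neg,
      latticeDot_planeVec, inner_smul_left, inner_smul_right, inner_complexPlaneVec, map_mul,
      map_add, map_neg, Complex.conj_I, Complex.conj_ofReal, map_intCast]
    push_cast
    linear_combination (-(2 : ℂ) * modeConst (m + 2) * N ^ 2 * t) * Complex.I_sq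
  have h3 := triadTerm_neg_swap (w := w) hvp.div_free (planeVec m (2 * N) 1, planeVec m N 0)
  have h4 := triadTerm_neg_swap (w := w) hvp.div_free (-planeVec m (2 * N) 1, -planeVec m N 0)
  simp only [neg_neg] at h3 h4
  rw [sobolevInner_nsBilinear_eq_tsum hn hp hvp hwp, tsum_eq_sum fun x hx => by
    rw [triadTerm_eq_zero hN hv hw hx, mul_zero]]
  rw [Finset.sum_insert, Finset.sum_insert, Finset.sum_insert, Finset.sum_singleton, h3, h4, h1,
    h2, latticeNorm_neg, latticeNorm_neg]
  · push_cast
    ring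
  all_goals
    simp only [Finset.mem_insert, Finset.mem_singleton, Prod.mk.injEq, neg_planeVec, planeVec_inj]
    omega

end

end

end

/-! ### The lower bound -/

lemma advecting_norm_le {m : ℕ} {N : ℤ} {v : Field (m + 2)} (hv0 : coeff v 0 = 0)
    (hv : ∀ k, coeff v k =
      (oddIndicator (planeVec m N 1) k * Complex.I) • complexPlaneVec m 1 (-N)) (hN : 1 ≤ N)
    (q : ℝ) : sobolevNorm q v ≤ 2 * latticeNorm (planeVec m N 1) ^ (q + 1) := by
  obtain ⟨hH, hH'⟩ := coeff_advecting_planeVec hN hv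
  have hρ : 0 < latticeNorm (planeVec m N 1) := by
    rw [latticeNorm_planeVec]; positivity
  have hnorm : ‖complexPlaneVec m 1 (-N)‖ = latticeNorm (planeVec m N 1) := by
    rw [norm_complexPlaneVec, latticeNorm_planeVec]
    congr 1
    push_cast
    ring
  refine (sobolevNorm_le_of_finset (S := {planeVec m N 1, -planeVec m N 1}) (M := 2)
    (B := latticeNorm (planeVec m N 1) ^ (q + 1)) hv0 ?_ Finset.card_le_two
    (by positivity) ?_).trans_eq (by norm_num)
  · intro k hk
    simp only [Finset.mem_insert, Finset.mem_singleton, not_or] at hk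
    rw [hv, oddIndicator_eq_zero hk.1 hk.2, zero_mul, zero_smul]
  · intro k hk
    simp only [Finset.mem_insert, Finset.mem_singleton] at hk
    rw [Real.rpow_add_one hρ.ne']
    rcases hk with rfl | rfl <;>
      simp [sobolevCoeff, hH, hH', norm_smul, hnorm, latticeNorm_neg]

lemma advected_norm_le {m : ℕ} {N : ℤ} {w : Field (m + 2)} {t : ℝ} (hw0 : coeff w 0 = 0)
    (hw : ∀ k, coeff w k =
      evenIndicator (planeVec m N 0) k • complexPlaneVec m 0 1 +
        (evenIndicator (planeVec m (2 * N) 1) k * t) • complexPlaneVec m 1 (-(2 * N)))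
    (hN : 1 ≤ N) (ht : 0 ≤ t) {q B : ℝ} (h1 : latticeNorm (planeVec m N 0) ^ q ≤ B)
    (h2 : latticeNorm (planeVec m (2 * N) 1) ^ q * (t * latticeNorm (planeVec m (2 * N) 1)) ≤ B) :
    sobolevNorm q w ≤ 4 * B := by
  obtain ⟨hL, hK⟩ := coeff_advected_planeVec hN hw
  obtain ⟨hL', hK'⟩ := coeff_advected_neg_planeVec hN hw
  have hnorm : ‖complexPlaneVec m 1 (-(2 * N))‖ = latticeNorm (planeVec m (2 * N) 1) := by
    rw [norm_complexPlaneVec, latticeNorm_planeVec]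
    congr 1
    push_cast
    ring
  refine (sobolevNorm_le_of_finset (S := {planeVec m N 0, -planeVec m N 0,
    planeVec m (2 * N) 1, -planeVec m (2 * N) 1}) (M := 4) (B := B) hw0 ?_ Finset.card_le_four
    ((Real.rpow_nonneg (latticeNorm_nonneg _) q).trans h1) ?_).trans_eq (by norm_num)
  · intro k hk
    simp only [Finset.mem_insert, Finset.mem_singleton, not_or] at hk
    rw [hw, evenIndicator_eq_zero hk.1 hk.2.1, evenIndicator_eq_zero hk.2.2.1 hk.2.2.2, zero_mul,
      zero_smul, zero_smul, add_zero]
  · intro k hk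
    have hone : ‖complexPlaneVec m 0 1‖ = 1 := by rw [norm_complexPlaneVec]; simp
    simp only [Finset.mem_insert, Finset.mem_singleton] at hk
    rcases hk with rfl | rfl | rfl | rfl
    · simpa [sobolevCoeff, hL, hone] using h1
    · simpa [sobolevCoeff, hL', hone, latticeNorm_neg] using h1
    · simpa [sobolevCoeff, hK, norm_smul, hnorm, abs_of_nonneg ht] using h2
    · simpa [sobolevCoeff, hK', norm_smul, hnorm, abs_of_nonneg ht, latticeNorm_neg] using h2

/-- Any constant of the tame Kato inequality is bounded below by a multiple of the `p`-th power of
`|(2N, 1)| / |(N, 1)|`. The amplitude `t = (|(N, 1)| / |(2N, 1)|)^p` of the frequency `(2N, 1)`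
balances the two parts of the norm of `w` of order `p`. -/
lemma exists_lower_bound (m : ℕ) {n : ℝ} (hn : ((m + 2 : ℕ) : ℝ) / 2 + 1 < n) {N : ℤ}
    (hN : 1 ≤ N) : ∃ c : ℝ, 0 < c ∧ ∀ p, n ≤ p → ∀ C ∈ tameKatoConstants (m + 2) p n,
      c * (latticeNorm (planeVec m (2 * N) 1) / latticeNorm (planeVec m N 1)) ^ p ≤ C := by
  set K := latticeNorm (planeVec m (2 * N) 1) with hKdef
  set ρ := latticeNorm (planeVec m N 1) with hρdef
  set L := latticeNorm (planeVec m N 0) with hLdef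
  have hNr : (1 : ℝ) ≤ N := by exact_mod_cast hN
  have hK2 : K ^ 2 = 4 * (N : ℝ) ^ 2 + 1 := by
    rw [hKdef, latticeNorm_planeVec, Real.sq_sqrt (by positivity)]
    push_cast
    ring
  have hρ2 : ρ ^ 2 = (N : ℝ) ^ 2 + 1 := by
    rw [hρdef, latticeNorm_planeVec, Real.sq_sqrt (by positivity)]
    push_cast
    ring
  have hL2 : L ^ 2 = (N : ℝ) ^ 2 := by
    rw [hLdef, latticeNorm_planeVec, Real.sq_sqrt (by positivity)]
    push_cast
    ring
  have hK0 : 0 < K := (latticeNorm_nonneg _).lt_of_ne' fun h => by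
    rw [← hKdef] at h
    rw [h] at hK2
    nlinarith
  have hρ0 : 0 < ρ := (latticeNorm_nonneg _).lt_of_ne' fun h => by
    rw [← hρdef] at h
    rw [h] at hρ2
    nlinarith
  have hL0 : 0 ≤ L := latticeNorm_nonneg _
  have hρK : ρ ≤ K := by nlinarith
  have hLρ : L ≤ ρ := by nlinarith
  have hK1 : 1 ≤ K := by nlinarith
  have hκ := modeConst_pos (m + 2)
  have hn0 : 0 < n := lt_trans (by positivity) hn
  set D := 16 * K * (ρ * K ^ (n + 1) + ρ ^ (n + 1) * K) with hD
  have hD0 : 0 < D := by positivity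
  refine ⟨2 * modeConst (m + 2) * N ^ 2 / D, by positivity, fun p hp C hC => ?_⟩
  have hp1 : 1 ≤ p := by
    have : (0 : ℝ) ≤ (m + 2 : ℕ) := Nat.cast_nonneg _
    linarith
  set t := (ρ / K) ^ p with ht
  have ht0 : 0 < t := by positivity
  have ht1 : t ≤ 1 := Real.rpow_le_one (by positivity) ((div_le_one hK0).mpr hρK) (by linarith)
  have hKt : K ^ p * t = ρ ^ p := by
    rw [ht, Real.div_rpow hρ0.le hK0.le]
    field_simp
  obtain ⟨v, hvm, hv⟩ := exists_advecting_field m hN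
  obtain ⟨w, hwm, hw⟩ := exists_advected_field m hN t
  have hvn : ∀ q, sobolevNorm q v ≤ 2 * ρ ^ (q + 1) :=
    advecting_norm_le (hvm 0).mean_zero hv hN
  have hwp : sobolevNorm p w ≤ 4 * (ρ ^ p * K) := by
    refine advected_norm_le (hwm 0).mean_zero hw hN ht0.le ?_ ?_
    · exact (Real.rpow_le_rpow hL0 hLρ (by linarith)).trans
        (le_mul_of_one_le_right (by positivity) hK1)
    · rw [← mul_assoc, hKt]
  have hwn : sobolevNorm n w ≤ 4 * K ^ (n + 1) := by
    rw [Real.rpow_add_one hK0.ne']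
    refine advected_norm_le (hwm 0).mean_zero hw hN ht0.le ?_ ?_
    · exact (Real.rpow_le_rpow hL0 (hLρ.trans hρK) hn0.le).trans
        (le_mul_of_one_le_right (by positivity) hK1)
    · exact mul_le_mul_of_nonneg_left (mul_le_of_le_one_left hK0.le ht1) (by positivity)
  have hkey := hC v w (hvm p) (hwm (p + 1))
  have hpow : ∀ x : ℝ, 0 ≤ x → x ^ (2 * p) = (x ^ 2) ^ p := fun x hx => by
    rw [Real.rpow_mul hx, Real.rpow_two]
  -- `L² ≤ K² / 2`, so at least half of the leading term `K^(2p)` survives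
  have hhalf : L ^ (2 * p) ≤ K ^ (2 * p) / 2 := by
    rw [hpow L hL0, hpow K hK0.le]
    calc (L ^ 2) ^ p ≤ (K ^ 2 * (1 / 2)) ^ p :=
          Real.rpow_le_rpow (by positivity) (by nlinarith) (by linarith)
      _ = (K ^ 2) ^ p * (1 / 2) ^ p := Real.mul_rpow (by positivity) (by norm_num)
      _ ≤ (K ^ 2) ^ p * (1 / 2) ^ (1 : ℝ) := mul_le_mul_of_nonneg_left
          (Real.rpow_le_rpow_of_exponent_ge (by norm_num) (by norm_num) hp1) (by positivity)
      _ = _ := by rw [Real.rpow_one]; ring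
  have hK2p : K ^ (2 * p) = K ^ p * K ^ p := by
    rw [two_mul, Real.rpow_add hK0]
  have hlow : 2 * modeConst (m + 2) * N ^ 2 * (K ^ p * ρ ^ p) ≤
      ‖sobolevInner p (nsBilinear v w) w‖ := by
    rw [sobolevInner_test_eq hn hp hN (hvm p) (hwm (p + 1)) hv hw, Complex.norm_real,
      Real.norm_eq_abs]
    refine le_trans ?_ (le_abs_self _)
    calc _ = K ^ (2 * p) / 2 * (4 * modeConst (m + 2) * N ^ 2 * t) := by
          rw [hK2p, ← hKt]; ring
      _ ≤ _ := mul_le_mul_of_nonneg_right (by linarith) (by positivity)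
  have hC0 : 0 ≤ C := by
    by_contra! hneg
    have h1 : 0 < 2 * modeConst (m + 2) * N ^ 2 * (K ^ p * ρ ^ p) := by positivity
    have h2 : 0 ≤ (sobolevNorm p v * sobolevNorm n w + sobolevNorm n v * sobolevNorm p w) *
        sobolevNorm p w := by
      have := sobolevNorm_nonneg p v
      have := sobolevNorm_nonneg n v
      have := sobolevNorm_nonneg p w
      have := sobolevNorm_nonneg n w
      positivity
    nlinarith [mul_nonneg (neg_nonneg.mpr hneg.le) h2]
  have hup : 1 / 2 * C * (sobolevNorm p v * sobolevNorm n w + sobolevNorm n v * sobolevNorm p w) *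
      sobolevNorm p w ≤ C * (ρ ^ p * ρ ^ p) * D := by
    have h1 := sobolevNorm_nonneg p v
    have h2 := sobolevNorm_nonneg n v
    have h3 := sobolevNorm_nonneg p w
    have h4 := sobolevNorm_nonneg n w
    calc _ ≤ 1 / 2 * C * ((2 * ρ ^ (p + 1)) * (4 * K ^ (n + 1)) +
          (2 * ρ ^ (n + 1)) * (4 * (ρ ^ p * K))) * (4 * (ρ ^ p * K)) := by
          gcongr
          · exact hvn p
          · exact hvn n
      _ = _ := by
          rw [Real.rpow_add_one hρ0.ne' p, hD]
          ring
  have hfin := hlow.trans (hkey.trans hup)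
  have hρp : 0 < ρ ^ p := by positivity
  rw [Real.div_rpow hK0.le hρ0.le, div_mul_div_comm, div_le_iff₀ (by positivity)]
  refine le_of_mul_le_mul_right ?_ hρp
  calc _ = 2 * modeConst (m + 2) * N ^ 2 * (K ^ p * ρ ^ p) := by ring
    _ ≤ _ := hfin
    _ = _ := by ring

/-! ### The sharp constant -/

lemma isClosed_tameKatoConstants (d : ℕ) (p n : ℝ) : IsClosed (tameKatoConstants d p n) := by
  simp only [tameKatoConstants, Set.ofPred_forall]
  refine isClosed_iInter fun v => isClosed_iInter fun w => isClosed_iInter fun _ =>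
    isClosed_iInter fun _ => isClosed_le continuous_const (by fun_prop)

lemma isLeast_sharpKato {d : ℕ} (hd : 2 ≤ d) {n p : ℝ} (hn : (d : ℝ) / 2 + 1 < n) (hp : n ≤ p) :
    IsLeast (tameKatoConstants d p n) (sharpKato d p n) := by
  have hb : BddBelow (tameKatoConstants d p n) := by
    obtain ⟨m, rfl⟩ := Nat.exists_eq_add_of_le' hd
    obtain ⟨c, _, h⟩ := exists_lower_bound m hn le_rfl
    exact ⟨_, fun C hC => h p hp C hC⟩
  exact ⟨(isClosed_tameKatoConstants d p n).csInf_mem ⟨_, mem_tameKatoConstants hd hn hp⟩ hb,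
    fun C hC => csInf_le hb hC⟩

lemma tendsto_const_rpow_one_div {c : ℝ} (hc : 0 < c) :
    Tendsto (fun p : ℝ => c ^ (1 / p)) atTop (𝓝 1) := by
  have h : Tendsto (fun p : ℝ => 1 / p) atTop (𝓝 0) := by
    simpa using tendsto_inv_atTop_zero
  simpa using (tendsto_const_nhds (x := c)).rpow h (Or.inl hc.ne')

/-- The ratio `|(2N, 1)| / |(N, 1)|` is as close to `2` as desired. -/
lemma exists_lt_latticeNorm_ratio (m : ℕ) {a : ℝ} (ha : a < 2) : ∃ N : ℤ, 1 ≤ N ∧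
    a < latticeNorm (planeVec m (2 * N) 1) / latticeNorm (planeVec m N 1) := by
  have h1 : Tendsto (fun N : ℕ => Real.sqrt (4 - 3 * (((N : ℝ) ^ 2 + 1)⁻¹))) atTop (𝓝 2) := by
    have h2 : Tendsto (fun N : ℕ => ((N : ℝ) ^ 2 + 1)⁻¹) atTop (𝓝 0) :=
      tendsto_inv_atTop_zero.comp (tendsto_atTop_add_const_right _ _
        ((tendsto_pow_atTop two_ne_zero).comp tendsto_natCast_atTop_atTop))
    have h3 := ((h2.const_mul 3).const_sub 4).sqrt
    have h4 : Real.sqrt (4 - 3 * 0) = 2 := by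
      rw [mul_zero, sub_zero, show (4 : ℝ) = 2 ^ 2 by norm_num, Real.sqrt_sq (by norm_num)]
    rwa [h4] at h3
  obtain ⟨N, hN1, hNa⟩ := ((eventually_ge_atTop 1).and (h1.eventually_const_lt ha)).exists
  refine ⟨N, by exact_mod_cast hN1, hNa.trans_eq ?_⟩
  rw [latticeNorm_planeVec, latticeNorm_planeVec, ← Real.sqrt_div (by positivity)]
  congr 1
  push_cast
  field_simp
  ring

lemma tendsto_sharpKato {d : ℕ} (hd : 2 ≤ d) {n : ℝ} (hn : (d : ℝ) / 2 + 1 < n) :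
    Tendsto (fun p : ℝ => sharpKato d p n ^ (1 / p)) atTop (𝓝 2) := by
  obtain ⟨m, rfl⟩ := Nat.exists_eq_add_of_le' hd
  have hn0 : 0 < n := lt_trans (by positivity) hn
  have hlow : ∀ a < 2, ∀ᶠ p in atTop, a < sharpKato (m + 2) p n ^ (1 / p) := by
    intro a ha
    obtain ⟨N, hN, hNa⟩ := exists_lt_latticeNorm_ratio m ha
    obtain ⟨c, hc, h⟩ := exists_lower_bound m hn hN
    set r := latticeNorm (planeVec m (2 * N) 1) / latticeNorm (planeVec m N 1) with hr
    have hr0 : 0 ≤ r := div_nonneg (latticeNorm_nonneg _) (latticeNorm_nonneg _)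
    have hlim := (tendsto_const_rpow_one_div hc).mul_const r
    rw [one_mul] at hlim
    filter_upwards [hlim.eventually_const_lt hNa, eventually_ge_atTop n] with p hp hpn
    have hp0 : 0 < p := hn0.trans_le hpn
    refine hp.trans_le ?_
    calc c ^ (1 / p) * r = (c * r ^ p) ^ (1 / p) := by
          rw [Real.mul_rpow hc.le (by positivity), ← Real.rpow_mul hr0,
            mul_one_div_cancel hp0.ne', Real.rpow_one]
      _ ≤ _ := Real.rpow_le_rpow (by positivity)
          (h p hpn _ (isLeast_sharpKato hd hn hpn).1) (by positivity)
  have hupp : ∀ a > 2, ∀ᶠ p in atTop, sharpKato (m + 2) p n ^ (1 / p) < a := by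
    intro a ha
    -- one is added to make the positivity of the constant evident
    set A := modeConst (m + 2) * embeddingConst (m + 2) n + 1 with hA
    have hE : 0 ≤ modeConst (m + 2) * embeddingConst (m + 2) n :=
      mul_nonneg (modeConst_pos _).le (Real.sqrt_nonneg _)
    have hA0 : 0 < A := by positivity
    have hlim := ((tendsto_const_rpow_one_div hA0).mul tendsto_rpow_div).mul_const 2
    rw [one_mul, one_mul] at hlim
    filter_upwards [hlim.eventually_lt_const ha, eventually_ge_atTop n] with p hp hpn
    have hp0 : 0 < p := hn0.trans_le hpn
    have hleast := isLeast_sharpKato hd hn hpn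
    have hS0 : 0 ≤ sharpKato (m + 2) p n := by
      obtain ⟨c, hc, h⟩ := exists_lower_bound m hn le_rfl
      refine le_trans ?_ (h p hpn _ hleast.1)
      exact mul_nonneg hc.le (Real.rpow_nonneg
        (div_nonneg (latticeNorm_nonneg _) (latticeNorm_nonneg _)) _)
    refine lt_of_le_of_lt ?_ hp
    calc sharpKato (m + 2) p n ^ (1 / p) ≤ (A * p * 2 ^ p) ^ (1 / p) := by
          refine Real.rpow_le_rpow hS0 ((hleast.2 (mem_tameKatoConstants hd hn hpn)).trans ?_)
            (by positivity)
          refine mul_le_mul (mul_le_mul_of_nonneg_right (by linarith) hp0.le)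
            (Real.rpow_le_rpow_of_exponent_le (by norm_num) (by linarith)) (by positivity)
            (by positivity)
      _ = _ := by
          rw [Real.mul_rpow (by positivity) (by positivity), Real.mul_rpow hA0.le hp0.le,
            ← Real.rpow_mul (by norm_num), mul_one_div_cancel hp0.ne', Real.rpow_one]
  exact tendsto_order.mpr ⟨hlow, hupp⟩

end TameKato

theorem mainTheorem4 (d : ℕ) (hd : 2 ≤ d) (n : ℝ) (hn : (d : ℝ) / 2 + 1 < n) :
    (∀ p : ℝ, n ≤ p →
      (∀ v w : TameKato.Field d, TameKato.MemSobolev p v → TameKato.MemSobolev (p + 1) w →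
        TameKato.MemSobolev p (TameKato.nsBilinear v w)) ∧
      IsLeast (TameKato.tameKatoConstants d p n) (TameKato.sharpKato d p n)) ∧
    Tendsto (fun p : ℝ => TameKato.sharpKato d p n ^ (1 / p)) atTop (𝓝 2) := by
  exact ⟨fun p hp => ⟨fun v w hv hw => (TameKato.nsBilinear_spec hn hp hv hw).1,
    TameKato.isLeast_sharpKato hd hn hp⟩, TameKato.tendsto_sharpKato hd hn⟩
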